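/- Let $q\in\mathbb C^*$ with $q^2\neq 1$, and let $\mathfrak g$ be a simple Lie algebra of simply laced type (or, more generally, fix any symmetric matrix $(\alpha_i,\alpha_j)$ with $(\alpha_i,\alpha_i)=2$ and $(\alpha_i,\alpha_j)\in\{0,-1\}$ for $i\ne j$). Let $U$ be the associative $\mathbb C$-algebra generated by the coefficients of the currents $e_\alpha(z)=\sum_{k\in\mathbb Z}e_{\alpha,k}z^{-k}$, $f_\alpha(z)=\sum_{k\in\mathbb Z}f_{\alpha,k}z^{-k}$, $K^\pm_\alpha(z)=\sum_{k\ge0}K^\pm_{\alpha,k}z^{\mp k}$ ($\alpha$ a simple root, $K^+_{\alpha,0}K^-_{\alpha,0}=K^-_{\alpha,0}K^+_{\alpha,0}=1$) and a central invertible element $q^{c/2}$, subject to all the relations of Drinfeld's new realization of $U_q(\widehat{\mathfrak g})$ except the Serre relations: $$(z-q^{(\alpha,\beta)}w)e_\alpha(z)e_\beta(w)=(q^{(\alpha,\beta)}z-w)e_\beta(w)e_\alpha(z),\qquad (z-q^{-(\alpha,\beta)}w)f_\alpha(z)f_\beta(w)=(q^{-(\alpha,\beta)}z-w)f_\beta(w)f_\alpha(z),$$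 $$(q^{\pm c/2}z-q^{(\alpha,\beta)}w)K^\pm_\alpha(z)e_\beta(w)=(q^{(\alpha,\beta)\pm c/2}z-w)e_\beta(w)K^\pm_\alpha(z),$$ $$(q^{\mp c/2}z-q^{-(\alpha,\beta)}w)K^\pm_\alpha(z)f_\beta(w)=(q^{-(\alpha,\beta)\mp c/2}z-w)f_\beta(w)K^\pm_\alpha(z),$$ $$(z-q^{(\alpha,\beta)-c}w)(z-q^{-(\alpha,\beta)+c}w)K^+_\alpha(z)K^-_\beta(w)=(q^{(\alpha,\beta)+c}z-w)(q^{-(\alpha,\beta)-c}z-w)K^-_\beta(w)K^+_\alpha(z),\qquad [K^\pm_\alpha(z),K^\pm_\beta(w)]=0,$$ $$[e_\alpha(z),f_\beta(w)]=\frac{\delta_{\alpha,\beta}}{q-q^{-1}}\Bigl(\delta(z/q^cw)K^+_\alpha(zq^{-c/2})-\delta(zq^c/w)K^-_\alpha(wq^{-c/2})\Bigr),\qquad \delta(z)=\sum_{k\in\mathbb Z}z^k.$$ Let $V$ be a representation of $U$ in which every vector is annihilated, for each simple root $\alpha$, by $e_{\alpha,n}$ and $f_{\alpha,n}$ for all sufficiently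 large $n$ (as in highest weight representations). Call a linear functional $\xi$ on $V$ restricted if, for each $\alpha$, $\xi\circ e_{\alpha,n}=\xi\circ f_{\alpha,n}=0$ for all sufficiently negative $n$. Fix simple roots $\alpha,\beta$ with $(\alpha,\beta)=-1$. Let $e_{\alpha+\beta}(z)=\,:e_\alpha(qz)e_\beta(q^2z):$ and $f_{\alpha+\beta}(z)=\,:f_\beta(q^2z)f_\alpha(qz):$ be the currents on $V$ defined by $$e_{\alpha+\beta}(z)=\frac1{2\pi i}\Bigl(\oint_{C_\infty}e_\alpha(w)e_\beta(q^2z)\frac{dw}w-\oint_{C_0}\frac{q^{-1}w-q^2z}{w-qz}e_\beta(q^2z)e_\alpha(w)\frac{dw}w\Bigr),$$ $$f_{\alpha+\beta}(z)=\frac1{2\pi i}\Bigl(\oint_{C_\infty}\frac{q^{-1}w-q^2z}{w-qz}f_\alpha(w)f_\beta(q^2z)\frac{dw}w-\oint_{C_0}f_\beta(q^2z)f_\alpha(w)\frac{dw}w\Bigr),$$ where $\frac1{2\pi i}\oint\frac{dw}{w}$ takes the coefficient of $w^0$ and the rational factor is expanded in the region $|w|<|qz|$ for $C_0$ and $|w|>|qz|$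 for $C_\infty$. Then: (a) For every $v\in V$, every restricted $\xi$ and every $z\neq 0$, the two series under the integrals for $e_{\alpha+\beta}$ (respectively $f_{\alpha+\beta}$), taken in the matrix coefficient $\langle\xi,\cdot\,v\rangle$, converge for $|w|>|qz|$ and for $0<|w|<|qz|$ to a single function $\Phi$ holomorphic for $w\ne 0,qz$, and $\langle\xi,e_{\alpha+\beta}(z)v\rangle$ (respectively $\langle\xi,f_{\alpha+\beta}(z)v\rangle$) equals $\frac1{2\pi i}\oint\Phi(w)\frac{dw}w$ over any circle around $w=qz$ of radius less than $|qz|$. (b) On $V$, the Serre relations $$x_\mu(w_1)x_\mu(w_2)x_\nu(z)-(q+q^{-1})x_\mu(w_1)x_\nu(z)x_\mu(w_2)+x_\nu(z)x_\mu(w_1)x_\mu(w_2)+(w_1\leftrightarrow w_2)=0$$ with $x=e$ or $f$ and $(\mu,\nu)=(\alpha,\beta)$ or $(\beta,\alpha)$ are equivalent to the following equalities of Laurent series (the fractions being expanded in the indicated regions): $$e_\alpha(z)e_{\alpha+\beta}(w)=\frac{qz-w}{z-qw}\,e_{\alpha+\beta}(w)e_\alpha(z),\quad |z|<|qw|,\tag{15}$$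 $$e_{\alpha+\beta}(z)e_\beta(w)=\frac{q^2z-q^{-2}w}{qz-q^{-1}w}\,e_\beta(w)e_{\alpha+\beta}(z),\quad |z|<|q^{-2}w|,\tag{16}$$ $$f_\beta(z)f_{\alpha+\beta}(w)=\frac{q^{-2}z-q^2w}{q^{-1}z-qw}\,f_{\alpha+\beta}(w)f_\beta(z),\quad |z|<|q^2w|,\tag{17}$$ $$f_{\alpha+\beta}(z)f_\alpha(w)=\frac{q^{-1}z-w}{z-q^{-1}w}\,f_\alpha(w)f_{\alpha+\beta}(z),\quad |z|<|q^{-1}w|.\tag{18}$$ More precisely, (15), (16), (17), (18) are respectively equivalent to the Serre relation for $(x,\mu,\nu)=(e,\alpha,\beta)$, $(e,\beta,\alpha)$, $(f,\beta,\alpha)$, $(f,\alpha,\beta)$. (c) When it holds, each of (15)–(18), written $X(z)Y(w)=\frac{az-bw}{cz-dw}Y(w)X(z)$, is also an identity of meromorphic functions on $(\mathbb C^*)^2$ in every matrix coefficient $\langle\xi,\cdot\,v\rangle$ with $v\in V$ and $\xi$ restricted: the series $X(z)Y(w)$ converges on all of $(\mathbb C^*)^2$ to a holomorphic function $F$, the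 series $Y(w)X(z)$ converges for $|az|<|bw|$ to a function $G$ that is holomorphic on $(\mathbb C^*)^2$ off $az=bw$, and $F=\frac{az-bw}{cz-dw}G$ wherever $az\ne bw$ and $cz\neq dw$. Conversely, if the restricted functionals separate the vectors of $V$, these identities imply the corresponding Serre relation. -/

import Mathlib

open scoped Real

namespace DrinfeldCurrent

noncomputable section

/-- Symmetric Cartan matrices of simply laced type, `A i j = (α_i, α_j)`. The Cartan matrix of every
simple Lie algebra of simply laced type (`A_n`, `D_n`, `E_6`, `E_7`, `E_8`) is of this kind. -/
structure IsSimplyLacedCartan {ι : Type*} (A : Matrix ι ι ℤ) : Prop where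
  diag : ∀ i, A i i = 2
  symm : ∀ i j, A i j = A j i
  offDiag : ∀ i j, i ≠ j → A i j = 0 ∨ A i j = -1

/-! ### The algebra of currents without the Serre relations -/

/-- Generators: the modes of `e_i(z) = ∑ e_{i,k} z^{-k}` and `f_i(z) = ∑ f_{i,k} z^{-k}`, the modes
of `K_i^+(z) = ∑_{k ≥ 0} K^+_{i,k} z^{-k}` and `K_i^-(z) = ∑_{k ≥ 0} K^-_{i,k} z^{k}`, and the central
element `γ = q^{c/2}` with its inverse. -/
inductive Gen (ι : Type*) where
  | e (i : ι) (k : ℤ)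
  | f (i : ι) (k : ℤ)
  | Kplus (i : ι) (k : ℕ)
  | Kminus (i : ι) (k : ℕ)
  | gamma
  | gammaInv

/-- The free algebra on the generators. -/
abbrev Free (ι : Type*) := FreeAlgebra ℂ (Gen ι)

namespace Free

variable {ι : Type*}

/-- `e_{i,n}`, the coefficient of `z^{-n}` in `e_i(z)`. -/
def e (i : ι) (n : ℤ) : Free ι := FreeAlgebra.ι ℂ (Gen.e i n)

/-- `f_{i,n}`, the coefficient of `z^{-n}` in `f_i(z)`. -/
def f (i : ι) (n : ℤ) : Free ι := FreeAlgebra.ι ℂ (Gen.f i n)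

/-- The coefficient of `z^{-n}` in `K_i^+(z)`; it vanishes for `n < 0`. -/
def Kp (i : ι) (n : ℤ) : Free ι :=
  if 0 ≤ n then FreeAlgebra.ι ℂ (Gen.Kplus i n.toNat) else 0

/-- The coefficient of `z^{-n}` in `K_i^-(z)`; it vanishes for `n > 0`. -/
def Km (i : ι) (n : ℤ) : Free ι :=
  if n ≤ 0 then FreeAlgebra.ι ℂ (Gen.Kminus i (-n).toNat) else 0

/-- `γ ^ n = q^{nc/2}` for an integer `n`. -/
def g (n : ℤ) : Free ι :=
  if 0 ≤ n then FreeAlgebra.ι ℂ Gen.gamma ^ n.toNat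
  else FreeAlgebra.ι ℂ Gen.gammaInv ^ (-n).toNat

end Free

open Free in
/-- The defining relations other than the Serre relations. Each constructor is the equality of the
coefficients of `z^{-n} w^{-m}` in the relation between currents that is displayed with it
(denominators cleared), with `a = (α_i, α_j)`. -/
inductive Rel {ι : Type*} [DecidableEq ι] (A : Matrix ι ι ℤ) (q : ℂ) : Free ι → Free ι → Prop
  | gamma_inv : Rel A q (g 1 * g (-1)) 1
  | inv_gamma : Rel A q (g (-1) * g 1) 1
  | gamma_central (x : Gen ι) :
      Rel A q (g 1 * FreeAlgebra.ι ℂ x) (FreeAlgebra.ι ℂ x * g 1)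
  /-- The constant terms of `K_i^±` are `k_i^{±1}`. -/
  | k_inv (i : ι) : Rel A q (Kp i 0 * Km i 0) 1
  | inv_k (i : ι) : Rel A q (Km i 0 * Kp i 0) 1
  /-- `(z - q^a w) e_i(z) e_j(w) = (q^a z - w) e_j(w) e_i(z)`. -/
  | ee (i j : ι) (n m : ℤ) :
      Rel A q (e i (n + 1) * e j m - q ^ A i j • (e i n * e j (m + 1)))
        (q ^ A i j • (e j m * e i (n + 1)) - e j (m + 1) * e i n)
  /-- `(z - q^{-a} w) f_i(z) f_j(w) = (q^{-a} z - w) f_j(w) f_i(z)`. -/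
  | ff (i j : ι) (n m : ℤ) :
      Rel A q (f i (n + 1) * f j m - q ^ (-A i j) • (f i n * f j (m + 1)))
        (q ^ (-A i j) • (f j m * f i (n + 1)) - f j (m + 1) * f i n)
  /-- `(γ z - q^a w) K_i^+(z) e_j(w) = (q^a γ z - w) e_j(w) K_i^+(z)`. -/
  | Kpe (i j : ι) (n m : ℤ) :
      Rel A q (g 1 * Kp i (n + 1) * e j m - q ^ A i j • (Kp i n * e j (m + 1)))
        (q ^ A i j • (g 1 * e j m * Kp i (n + 1)) - e j (m + 1) * Kp i n)
  /-- `(γ⁻¹ z - q^a w) K_i^-(z) e_j(w) = (q^a γ⁻¹ z - w) e_j(w) K_i^-(z)`. -/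
  | Kme (i j : ι) (n m : ℤ) :
      Rel A q (g (-1) * Km i (n + 1) * e j m - q ^ A i j • (Km i n * e j (m + 1)))
        (q ^ A i j • (g (-1) * e j m * Km i (n + 1)) - e j (m + 1) * Km i n)
  /-- `(γ⁻¹ z - q^{-a} w) K_i^+(z) f_j(w) = (q^{-a} γ⁻¹ z - w) f_j(w) K_i^+(z)`. -/
  | Kpf (i j : ι) (n m : ℤ) :
      Rel A q (g (-1) * Kp i (n + 1) * f j m - q ^ (-A i j) • (Kp i n * f j (m + 1)))
        (q ^ (-A i j) • (g (-1) * f j m * Kp i (n + 1)) - f j (m + 1) * Kp i n)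
  /-- `(γ z - q^{-a} w) K_i^-(z) f_j(w) = (q^{-a} γ z - w) f_j(w) K_i^-(z)`. -/
  | Kmf (i j : ι) (n m : ℤ) :
      Rel A q (g 1 * Km i (n + 1) * f j m - q ^ (-A i j) • (Km i n * f j (m + 1)))
        (q ^ (-A i j) • (g 1 * f j m * Km i (n + 1)) - f j (m + 1) * Km i n)
  /-- `(z - q^a γ⁻² w)(z - q^{-a} γ² w) K_i^+(z) K_j^-(w)
      = (q^a γ² z - w)(q^{-a} γ⁻² z - w) K_j^-(w) K_i^+(z)`. -/
  | KpKm (i j : ι) (n m : ℤ) :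
      Rel A q
        (Kp i (n + 2) * Km j m
          - (q ^ A i j • g (-2) + q ^ (-A i j) • g 2) * (Kp i (n + 1) * Km j (m + 1))
          + Kp i n * Km j (m + 2))
        (Km j m * Kp i (n + 2)
          - (q ^ A i j • g 2 + q ^ (-A i j) • g (-2)) * (Km j (m + 1) * Kp i (n + 1))
          + Km j (m + 2) * Kp i n)
  | KpKp (i j : ι) (n m : ℤ) : Rel A q (Kp i n * Kp j m) (Kp j m * Kp i n)
  | KmKm (i j : ι) (n m : ℤ) : Rel A q (Km i n * Km j m) (Km j m * Km i n)
  /-- `[e_i(z), f_j(w)]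
      = δ_{ij} (q - q⁻¹)⁻¹ (δ(z / γ² w) K_i^+(z γ⁻¹) - δ(z γ² / w) K_i^-(w γ⁻¹))`. -/
  | ef (i j : ι) (n m : ℤ) :
      Rel A q (e i n * f j m - f j m * e i n)
        (if i = j then
          (q - q⁻¹)⁻¹ • (g (n - m) * Kp i (n + m) - g (m - n) * Km i (n + m))
        else 0)

/-- The algebra generated by the currents `e_i`, `f_i`, `K_i^±` subject to all the defining relations
of the quantum affine algebra in its new realization except the Serre relations. -/
abbrev Alg {ι : Type*} [DecidableEq ι] (A : Matrix ι ι ℤ) (q : ℂ) := RingQuot (Rel A q)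

section Modes

variable {ι : Type*} [DecidableEq ι] (A : Matrix ι ι ℤ) (q : ℂ)

/-- The mode `e_{i,n}` in the algebra. -/
def eMode (i : ι) (n : ℤ) : Alg A q := RingQuot.mkAlgHom ℂ (Rel A q) (Free.e i n)

/-- The mode `f_{i,n}` in the algebra. -/
def fMode (i : ι) (n : ℤ) : Alg A q := RingQuot.mkAlgHom ℂ (Rel A q) (Free.f i n)

end Modes

/-! ### Serre relations -/

/-- The coefficient of `w_1^{-n_1} w_2^{-n_2} z^{-m}` in
`x(w_1)x(w_2)y(z) - [2]_q x(w_1)y(z)x(w_2) + y(z)x(w_1)x(w_2)`. -/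
def serreHalf {R : Type*} [Ring R] [Algebra ℂ R] (q : ℂ) (x y : ℤ → R) (n₁ n₂ m : ℤ) : R :=
  x n₁ * x n₂ * y m - (q + q⁻¹) • (x n₁ * y m * x n₂) + y m * x n₁ * x n₂

/-- The coefficient of `w_1^{-n_1} w_2^{-n_2} z^{-m}` in the left-hand side of the Serre relation
for the currents `x`, `y`. -/
def serre {R : Type*} [Ring R] [Algebra ℂ R] (q : ℂ) (x y : ℤ → R) (n₁ n₂ m : ℤ) : R :=
  serreHalf q x y n₁ n₂ m + serreHalf q x y n₂ n₁ m

/-! ### Representations -/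

section Rep

variable {ι : Type*} [DecidableEq ι] {A : Matrix ι ι ℤ} {q : ℂ}
variable {V : Type*} [AddCommGroup V] [Module ℂ V]

/-- The property that characterizes the category of highest weight representations: every vector is
annihilated by the modes `e_{i,n}`, `f_{i,n}` with `n` big enough. -/
def IsHighestWeight (ρ : Alg A q →ₐ[ℂ] Module.End ℂ V) : Prop :=
  ∀ (v : V) (i : ι), ∃ N : ℤ, ∀ n ≥ N, ρ (eMode A q i n) v = 0 ∧ ρ (fMode A q i n) v = 0

/-- The restricted dual: functionals that are annihilated by the (transposed) modes `e_{i,n}`,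
`f_{i,n}` with `-n` big enough. Matrix coefficients are taken against these. -/
def IsRestricted (ρ : Alg A q →ₐ[ℂ] Module.End ℂ V) (ξ : V →ₗ[ℂ] ℂ) : Prop :=
  ∀ i : ι, ∃ N : ℤ, ∀ n ≤ N, ∀ v : V, ξ (ρ (eMode A q i n) v) = 0 ∧ ξ (ρ (fMode A q i n) v) = 0

/-- The restricted dual separates the vectors of the representation. -/
def RestrictedSeparates (ρ : Alg A q →ₐ[ℂ] Module.End ℂ V) : Prop :=
  ∀ v : V, (∀ ξ : V →ₗ[ℂ] ℂ, IsRestricted ρ ξ → ξ v = 0) → v = 0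

/-- The current `e_i(z)` acting on the representation, through its modes. -/
def eCur (ρ : Alg A q →ₐ[ℂ] Module.End ℂ V) (i : ι) (n : ℤ) (v : V) : V := ρ (eMode A q i n) v

/-- The current `f_i(z)` acting on the representation, through its modes. -/
def fCur (ρ : Alg A q →ₐ[ℂ] Module.End ℂ V) (i : ι) (n : ℤ) (v : V) : V := ρ (fMode A q i n) v

/-- The Serre relation between `e_i` (twice) and `e_j` holds in the representation. -/
def SerreE (ρ : Alg A q →ₐ[ℂ] Module.End ℂ V) (i j : ι) : Prop :=
  ∀ n₁ n₂ m : ℤ, ρ (serre q (eMode A q i) (eMode A q j) n₁ n₂ m) = 0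

/-- The Serre relation between `f_i` (twice) and `f_j` holds in the representation. -/
def SerreF (ρ : Alg A q →ₐ[ℂ] Module.End ℂ V) (i j : ι) : Prop :=
  ∀ n₁ n₂ m : ℤ, ρ (serre q (fMode A q i) (fMode A q j) n₁ n₂ m) = 0

end Rep

/-! ### Laurent series in two variables with values in operators

A current is given by its modes `X : ℤ → V → V`, `X(z) = ∑ X_n z^{-n}`; a series in `z, w` by
`S : ℤ → ℤ → V → V`, where `S n m` is the coefficient of `z^{-n} w^{-m}`. -/

section Series

variable {V : Type*} [AddCommGroup V] [Module ℂ V]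

/-- The Laurent expansion of `(a z - b w) / (c z - d w)` in the region `|c z| < |d w|`, as a power
series in `t = z / w` (for `d ≠ 0`). -/
def ratio (a b c d : ℂ) : PowerSeries ℂ :=
  (PowerSeries.C b - PowerSeries.C a * PowerSeries.X) *
    (PowerSeries.C d - PowerSeries.C c * PowerSeries.X)⁻¹

/-- The product of the series `r(z/w)` and `S(z, w)`. For every series to which it is applied here,
the sum over `k` is finite on each vector of a highest weight representation. -/
def seriesMul (r : PowerSeries ℂ) (S : ℤ → ℤ → V → V) (n m : ℤ) (v : V) : V :=
  ∑ᶠ k : ℕ, PowerSeries.coeff k r • S (n + k) (m - k) v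

/-- The equality of Laurent series
`X(z) Y(w) = (a z - b w)/(c z - d w) Y(w) X(z)`, `|c z| < |d w|`. -/
def Exchange (a b c d : ℂ) (X Y : ℤ → V → V) : Prop :=
  ∀ (n m : ℤ) (v : V),
    X n (Y m v) = seriesMul (ratio a b c d) (fun n' m' u => Y m' (X n' u)) n m v

/-- The analytic continuation of `X(z) Y(w)` into the region `|z| < |p w|`, as the Laurent series
`(p z - w)/(z - p w) Y(w) X(z)`, for currents with `(z - p w) X(z) Y(w) = (p z - w) Y(w) X(z)`. -/
def continued (p : ℂ) (X Y : ℤ → V → V) : ℤ → ℤ → V → V :=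
  seriesMul (ratio p 1 1 p) (fun n m u => Y m (X n u))

/-- Let `outer` and `inner` be the Laurent series in `w, x` (coefficients of `w^{-n} x^{-m}`) of the
same function in the regions `|w| > |q⁻¹ x|` and `|w| < |q⁻¹ x|`. With `x = q² z`, this is the mode
of index `n` of
`(2πi)⁻¹ (∮_{C_∞} outer(w, q² z) dw/w - ∮_{C_0} inner(w, q² z) dw/w)`,
the contour integrals being coefficients of `w^0`. -/
def contourDifference (q : ℂ) (outer inner : ℤ → ℤ → V → V) (n : ℤ) (v : V) : V :=
  q ^ (-2 * n) • (outer 0 n v - inner 0 n v)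

/-- The product `ea(w) eb(x)` in the region `|w| > |q⁻¹ x|`. -/
def outerE (ea eb : ℤ → V → V) (n m : ℤ) (v : V) : V := ea n (eb m v)

/-- The product `ea(w) eb(x)` continued to the region `|w| < |q⁻¹ x|`. -/
def innerE (q : ℂ) (ea eb : ℤ → V → V) (n m : ℤ) (v : V) : V := continued q⁻¹ ea eb n m v

/-- The product `fb(x) fa(w)` continued to the region `|x| < |q w|`. -/
def outerF (q : ℂ) (fa fb : ℤ → V → V) (n m : ℤ) (v : V) : V := continued q fb fa m n v

/-- The product `fb(x) fa(w)` in the region `|x| > |q w|`. -/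
def innerF (fa fb : ℤ → V → V) (n m : ℤ) (v : V) : V := fb m (fa n v)

/-- The composed root current `e_{α+β}(z) = :e_α(qz) e_β(q²z):`. -/
def composedE (q : ℂ) (ea eb : ℤ → V → V) : ℤ → V → V :=
  contourDifference q (outerE ea eb) (innerE q ea eb)

/-- The composed root current `f_{α+β}(z) = :f_β(q²z) f_α(qz):`. -/
def composedF (q : ℂ) (fa fb : ℤ → V → V) : ℤ → V → V :=
  contourDifference q (outerF q fa fb) (innerF fa fb)

/-! ### Matrix coefficients as analytic functions -/

/-- In the matrix coefficient `⟨ξ, · v⟩`, for every `z ≠ 0` the series `outer(w, q² z)` and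
`inner(w, q² z)` converge for `|w| > |qz|` and `0 < |w| < |qz|` to one function `Φ`, holomorphic for
`w ≠ 0, qz`, and
`C(z) = (2πi)⁻¹ ∮ Φ(w) dw/w` over a circle around `w = qz`. -/
def IsContourIntegral (q : ℂ) (outer inner : ℤ → ℤ → V → V) (C : ℤ → V → V)
    (ξ : V →ₗ[ℂ] ℂ) (v : V) : Prop :=
  ∀ z : ℂ, z ≠ 0 → ∃ Φ : ℂ → ℂ,
    DifferentiableOn ℂ Φ {w | w ≠ 0 ∧ w ≠ q * z} ∧
    (∀ w : ℂ, ‖q * z‖ < ‖w‖ →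
      HasSum (fun p : ℤ × ℤ => ξ (outer p.1 p.2 v) * w ^ (-p.1) * (q ^ 2 * z) ^ (-p.2)) (Φ w)) ∧
    (∀ w : ℂ, w ≠ 0 → ‖w‖ < ‖q * z‖ →
      HasSum (fun p : ℤ × ℤ => ξ (inner p.1 p.2 v) * w ^ (-p.1) * (q ^ 2 * z) ^ (-p.2)) (Φ w)) ∧
    (∀ r : ℝ, 0 < r → r < ‖q * z‖ →
      HasSum (fun n : ℤ => ξ (C n v) * z ^ (-n))
        ((2 * π * Complex.I)⁻¹ * ∮ w in C(q * z, r), Φ w / w))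

/-- In the matrix coefficient `⟨ξ, · v⟩`, the identity of meromorphic functions on `(ℂ^*)²`
`X(z) Y(w) = (a z - b w)/(c z - d w) Y(w) X(z)`:
the series `X(z) Y(w)` converges on all of `(ℂ^*)²` to a holomorphic function `F`, the series
`Y(w) X(z)` converges for `|a z| < |b w|` to a function `G` holomorphic on `(ℂ^*)²` off the line
`a z = b w`, and `F = (a z - b w)/(c z - d w) G`. -/
def AnalyticExchange (a b c d : ℂ) (X Y : ℤ → V → V) (ξ : V →ₗ[ℂ] ℂ) (v : V) : Prop :=
  ∃ F G : ℂ × ℂ → ℂ,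
    AnalyticOnNhd ℂ F {p | p.1 ≠ 0 ∧ p.2 ≠ 0} ∧
    AnalyticOnNhd ℂ G {p | p.1 ≠ 0 ∧ p.2 ≠ 0 ∧ a * p.1 ≠ b * p.2} ∧
    (∀ z w : ℂ, z ≠ 0 → w ≠ 0 →
      HasSum (fun p : ℤ × ℤ => ξ (X p.1 (Y p.2 v)) * z ^ (-p.1) * w ^ (-p.2)) (F (z, w))) ∧
    (∀ z w : ℂ, z ≠ 0 → w ≠ 0 → ‖a * z‖ < ‖b * w‖ →
      HasSum (fun p : ℤ × ℤ => ξ (Y p.2 (X p.1 v)) * z ^ (-p.1) * w ^ (-p.2)) (G (z, w))) ∧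
    (∀ z w : ℂ, z ≠ 0 → w ≠ 0 → a * z ≠ b * w → c * z ≠ d * w →
      F (z, w) = (a * z - b * w) / (c * z - d * w) * G (z, w))

end Series

section ExchangeInRep

variable {ι : Type*} [DecidableEq ι] {A : Matrix ι ι ℤ} {q : ℂ}
variable {V : Type*} [AddCommGroup V] [Module ℂ V]

/-- `AnalyticExchange` in all the matrix coefficients of a representation. -/
def AnalyticExchangeIn (ρ : Alg A q →ₐ[ℂ] Module.End ℂ V) (a b c d : ℂ) (X Y : ℤ → V → V) : Prop :=
  ∀ (ξ : V →ₗ[ℂ] ℂ) (v : V), IsRestricted ρ ξ → AnalyticExchange a b c d X Y ξ v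

/-- `X(z) Y(w) = (a z - b w)/(c z - d w) Y(w) X(z)` is equivalent to the relation `S`: as an equality
of Laurent series (`|c z| < |d w|`), and then also as an identity of meromorphic functions on
`(ℂ^*)²`, which conversely suffices if the matrix coefficients determine the operators. -/
def EquivalentToExchange (ρ : Alg A q →ₐ[ℂ] Module.End ℂ V) (S : Prop) (a b c d : ℂ)
    (X Y : ℤ → V → V) : Prop :=
  (S ↔ Exchange a b c d X Y) ∧
  (S → AnalyticExchangeIn ρ a b c d X Y) ∧
  (RestrictedSeparates ρ → AnalyticExchangeIn ρ a b c d X Y → S)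

end ExchangeInRep

end

end DrinfeldCurrent

open DrinfeldCurrent

namespace DrinfeldCurrent

noncomputable section

/-! ### Expansions of the exchange factors -/

section Ratio

variable {a b c d : ℂ}

/-! The e-currents and the f-currents are treated together: `CurrentPair s a b` with s = q⁻¹, (a, b)
= (e_α, e_β), or s = q, (a, b) = (f_β, f_α). Both a(x)b(y) and the continued series `cont` solve (x
- sy)·S = (sx - y) b(y)a(x), so their difference is killed by x - sy and equals C(y)δ(sy/x). The
modes of C are `fused` (`mul_eq`); up to a sign and a rescaling of the argument, C is the composed
root current (`composedE_eq`, `composedF_eq`).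

Formal equivalence. Substituting a(x)b(y) = C(y)δ(sy/x) + cont into the cubic expression
a(x₁)a(x₂)b(y) - (s + s⁻¹)a(x₁)b(y)a(x₂) + b(y)a(x₁)a(x₂) and symmetrizing, the delta terms assemble
into δ(sy/x₂) times the defect of the exchange relation between a(x₁) and C(y), plus the same with
x₁, x₂ interchanged. The symmetrized remainder W is zero: the quadratic relations alone show that
(x₁ - sy)(x₂ - sy) kills the Serre expression, hence also W, while W is bounded on each vector, and
a bounded series killed by a linear factor vanishes (`eq_zero_of_recursion`). So Serre is a sum of
two delta functions times defects (`serre_left_eq`, `serre_right_eq`), and the coefficient with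
equal indices in the doubled current is twice a nonzero multiple of a single defect. This gives both
directions.

Analytic part. In a restricted matrix coefficient, (x - sy)a(x)b(y) is a Laurent polynomial P: one
side of the quadratic relation bounds its exponents from two directions and the other side from the
remaining two. Hence the two expansions are those of P/(x - sy), and C(y) is its residue
(`matrixCoeff`). Similarly, a formal exchange relation makes X(z)Y(w) a Laurent polynomial
(`analyticExchange_of_exchange`). Conversely, the formal and the analytic versions could differ only
by a delta function on the pole cz = dw, which convergence of X(z)Y(w) on that line excludes
(`apply_eq_of_analyticExchange`). -/

theorem ratio_mul (hd : d ≠ 0) :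
    ratio a b c d * (PowerSeries.C d - PowerSeries.C c * PowerSeries.X) =
      PowerSeries.C b - PowerSeries.C a * PowerSeries.X := by
  rw [ratio, mul_assoc, PowerSeries.inv_mul_cancel, mul_one]
  simpa using hd

theorem ratio_coeff_zero (hd : d ≠ 0) : PowerSeries.coeff 0 (ratio a b c d) = b / d := by
  have h := congrArg (PowerSeries.coeff 0) (ratio_mul (a := a) (b := b) (c := c) hd)
  simp at h
  rw [PowerSeries.coeff_zero_eq_constantCoeff_apply, eq_div_iff hd, h]

theorem ratio_coeff_succ (hd : d ≠ 0) (k : ℕ) :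
    d * PowerSeries.coeff (k + 1) (ratio a b c d) =
      c * PowerSeries.coeff k (ratio a b c d) - if k = 0 then a else 0 := by
  have h := congrArg (PowerSeries.coeff (k + 1)) (ratio_mul (a := a) (b := b) (c := c) hd)
  rw [mul_sub, mul_left_comm, map_sub, PowerSeries.coeff_mul_C, PowerSeries.coeff_C_mul,
    PowerSeries.coeff_succ_mul_X, map_sub, PowerSeries.coeff_C_mul, PowerSeries.coeff_X,
    PowerSeries.coeff_C] at h
  simp only [Nat.add_eq_zero_iff, one_ne_zero, and_false, if_false, Nat.add_eq_right] at h
  split_ifs at h ⊢ <;> linear_combination h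

theorem ratio_coeff (hd : d ≠ 0) (k : ℕ) :
    PowerSeries.coeff (k + 1) (ratio a b c d) = (b * c - a * d) / d ^ 2 * (c / d) ^ k := by
  induction k with
  | zero =>
    have h := ratio_coeff_succ (a := a) (b := b) (c := c) hd 0
    rw [ratio_coeff_zero hd] at h
    simp only [if_true] at h
    field_simp at h ⊢
    linear_combination h
  | succ k ih =>
    have h := ratio_coeff_succ (a := a) (b := b) (c := c) hd (k + 1)
    rw [ih] at h
    simp only [Nat.add_eq_zero_iff, one_ne_zero, and_false, if_false] at h
    rw [pow_succ, ← mul_right_inj' hd, h]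
    linear_combination -((b * c - a * d) / d ^ 2 * (c / d) ^ k) * mul_div_cancel₀ c hd

/-- Rescaling the first variable of the exchange factor. -/
theorem ratio_coeff_rescale (hd : d ≠ 0) (t : ℂ) (k : ℕ) :
    PowerSeries.coeff k (ratio (a * t) b (c * t) d) =
      t ^ k * PowerSeries.coeff k (ratio a b c d) := by
  cases k with
  | zero => simp [ratio_coeff_zero hd, -PowerSeries.coeff_zero_eq_constantCoeff]
  | succ k => rw [ratio_coeff hd, ratio_coeff hd, mul_div_right_comm, mul_pow]; ring

/-- The exchange factor does not change if numerator and denominator are multiplied by `t`. -/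
theorem ratio_homogeneous (hd : d ≠ 0) {t : ℂ} (ht : t ≠ 0) :
    ratio (t * a) (t * b) (t * c) (t * d) = ratio a b c d := by
  ext k
  cases k with
  | zero => rw [ratio_coeff_zero hd, ratio_coeff_zero (mul_ne_zero ht hd)]; field_simp
  | succ k =>
    rw [ratio_coeff hd, ratio_coeff (mul_ne_zero ht hd), mul_div_mul_left _ _ ht]; field_simp

/-- This is where the exchange factor of a with C comes from: it is the q-integer of the Serre
relation minus the factor that continues a(x)b(y). -/
theorem ratio_eq_sub {s : ℂ} (hs : s ≠ 0) :
    ratio s⁻¹ (s ^ 2) 1 s = PowerSeries.C (s + s⁻¹) - ratio s 1 1 s := by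
  have h : (PowerSeries.C s - PowerSeries.C 1 * PowerSeries.X : PowerSeries ℂ) ≠ 0 := by
    intro h
    have := congrArg (PowerSeries.coeff 0) h
    simp at this
    exact hs this
  apply mul_right_cancel₀ h
  rw [sub_mul, ratio_mul hs, ratio_mul hs, mul_sub, ← mul_assoc, ← map_mul, ← map_mul,
    show (s + s⁻¹) * s = s ^ 2 + 1 by field_simp]
  simp only [map_add, mul_one]
  ring

end Ratio

/-! ### Products of a power series in `z / w` with a series of operators -/

section SeriesMul

variable {V : Type*} [AddCommGroup V] [Module ℂ V]

theorem seriesMul_eq_sum (r : PowerSeries ℂ) {S : ℤ → ℤ → V → V} {n m : ℤ} {v : V} {K : ℕ}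
    (h : ∀ k : ℕ, K ≤ k → S (n + k) (m - k) v = 0) :
    seriesMul r S n m v =
      ∑ k ∈ Finset.range K, PowerSeries.coeff k r • S (n + k) (m - k) v := by
  apply finsum_eq_sum_of_support_subset
  intro k hk
  simp only [Function.mem_support, Finset.coe_range, Set.mem_Iio] at hk ⊢
  by_contra hK
  exact hk (by rw [h k (by omega), smul_zero])

theorem seriesMul_eq_zero (r : PowerSeries ℂ) {S : ℤ → ℤ → V → V} {n m : ℤ} {v : V}
    (h : ∀ k : ℕ, S (n + k) (m - k) v = 0) : seriesMul r S n m v = 0 := by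
  rw [seriesMul_eq_sum r (K := 0) fun k _ => h k, Finset.sum_range_zero]

/-- A bound on the first index makes the product a finite sum of a length that is uniform in the
second index. -/
theorem seriesMul_eq_sum_of_bound (r : PowerSeries ℂ) {S : ℤ → ℤ → V → V} {v : V} {N : ℤ}
    (h : ∀ n ≥ N, ∀ m, S n m v = 0) {n : ℤ} {K : ℕ} (hK : N ≤ n + K) (m : ℤ) :
    seriesMul r S n m v =
      ∑ k ∈ Finset.range K, PowerSeries.coeff k r • S (n + k) (m - k) v :=
  seriesMul_eq_sum r fun k hk => h _ (by omega) _

theorem seriesMul_eq_zero_of_bound (r : PowerSeries ℂ) {S : ℤ → ℤ → V → V} {v : V} {N : ℤ}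
    (h : ∀ n ≥ N, ∀ m, S n m v = 0) {n : ℤ} (hn : N ≤ n) (m : ℤ) : seriesMul r S n m v = 0 :=
  seriesMul_eq_zero r fun k => h _ (by omega) _

/-- `(c z - d w) r(z/w) S(z, w) = (a z - b w) S(z, w)` for `r` the expansion of
`(a z - b w) / (c z - d w)`. -/
theorem seriesMul_ratio {a b c d : ℂ} (hd : d ≠ 0) {S : ℤ → ℤ → V → V} {v : V} {N : ℤ}
    (h : ∀ n ≥ N, ∀ m, S n m v = 0) (n m : ℤ) :
    c • seriesMul (ratio a b c d) S (n + 1) m v - d • seriesMul (ratio a b c d) S n (m + 1) v =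
      a • S (n + 1) m v - b • S n (m + 1) v := by
  obtain ⟨K, hK⟩ : ∃ K : ℕ, N ≤ n + 1 + K := ⟨(N - n - 1).toNat, by omega⟩
  -- The second sum is one term longer, so that splitting off its k = 0 term aligns the rest with
  -- the first sum.
  rw [seriesMul_eq_sum_of_bound _ h (K := K + 1) (by push_cast; omega),
    seriesMul_eq_sum_of_bound _ h (K := K + 1 + 1) (by push_cast; omega),
    Finset.sum_range_succ' _ (K + 1), smul_add, Finset.smul_sum, Finset.smul_sum, ← sub_sub,
    ← Finset.sum_sub_distrib]
  have h1 : ∀ k : ℕ, c • PowerSeries.coeff k (ratio a b c d) • S (n + 1 + k) (m - k) v -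
      d • PowerSeries.coeff (k + 1) (ratio a b c d) • S (n + (k + 1 : ℕ)) (m + 1 - (k + 1 : ℕ)) v =
      (if k = 0 then a else 0) • S (n + 1 + k) (m - k) v := by
    intro k
    rw [show n + ((k + 1 : ℕ) : ℤ) = n + 1 + k by push_cast; ring,
      show m + 1 - ((k + 1 : ℕ) : ℤ) = m - k by push_cast; ring, smul_smul, smul_smul,
      ratio_coeff_succ hd, ← sub_smul]
    congr 1
    ring
  rw [Finset.sum_congr rfl fun k _ => h1 k, Finset.sum_range_succ']
  simp only [Nat.add_eq_zero_iff, one_ne_zero, and_false, if_false, zero_smul,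
    Finset.sum_const_zero, if_true, zero_add, ratio_coeff_zero hd, smul_smul, mul_div_cancel₀ _ hd]
  simp

/-- A homogeneous solution that vanishes for large first index is zero. -/
theorem eq_zero_of_recursion {M : Type*} [AddCommGroup M] [Module ℂ M] {c d : ℂ} (hd : d ≠ 0)
    {D : ℤ → ℤ → M} (hD : ∀ n m, c • D (n + 1) m = d • D n (m + 1)) {N : ℤ}
    (hN : ∀ n ≥ N, ∀ m, D n m = 0) (n m : ℤ) : D n m = 0 := by
  have key : ∀ k : ℕ, ∀ m, D (N - k) m = 0 := by
    intro k
    induction k with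
    | zero => intro m; exact hN _ (by simp) m
    | succ k ih =>
      intro m
      have h := hD (N - (k + 1 : ℕ)) (m - 1)
      rw [show N - ((k + 1 : ℕ) : ℤ) + 1 = N - k by push_cast; ring, ih, smul_zero,
        sub_add_cancel] at h
      exact (smul_eq_zero.1 h.symm).resolve_left hd
  by_cases hn : N ≤ n
  · exact hN n hn m
  · have := key (N - n).toNat m
    rwa [show N - ((N - n).toNat : ℤ) = n by omega] at this

theorem seriesMul_C_sub (t : ℂ) (r : PowerSeries ℂ) {S : ℤ → ℤ → V → V} {v : V} {N : ℤ}
    (h : ∀ n ≥ N, ∀ m, S n m v = 0) (n m : ℤ) :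
    seriesMul (PowerSeries.C t - r) S n m v = t • S n m v - seriesMul r S n m v := by
  obtain ⟨K, hK⟩ : ∃ K : ℕ, N ≤ n + (K + 1 : ℕ) := ⟨(N - n).toNat, by push_cast; omega⟩
  rw [seriesMul_eq_sum_of_bound _ h hK, seriesMul_eq_sum_of_bound _ h hK]
  simp only [map_sub, sub_smul, Finset.sum_sub_distrib]
  congr 1
  rw [Finset.sum_range_succ']
  simp [PowerSeries.coeff_C]

/-- Lets functionals pass through the product. A W-valued series is encoded as a series of constant
operators on W, so the vector 0 at which it is evaluated is a dummy. -/
theorem map_seriesMul {W : Type*} [AddCommGroup W] [Module ℂ W] (L : V →ₗ[ℂ] W)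
    (r : PowerSeries ℂ) {S : ℤ → ℤ → V → V} {v : V} {N : ℤ}
    (h : ∀ n ≥ N, ∀ m, S n m v = 0) (n m : ℤ) :
    L (seriesMul r S n m v) = seriesMul r (fun n m (_ : W) => L (S n m v)) n m 0 := by
  obtain ⟨K, hK⟩ : ∃ K : ℕ, N ≤ n + K := ⟨(N - n).toNat, by omega⟩
  rw [seriesMul_eq_sum_of_bound _ h hK,
    seriesMul_eq_sum_of_bound (N := N) _ (fun n hn m => by rw [h n hn, map_zero]) hK, map_sum]
  simp only [map_smul]

end SeriesMul

/-! ### The fused current of a pair of currents -/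

section Fused

variable {V : Type*} [AddCommGroup V] [Module ℂ V]

/-- Currents `a`, `b` on a highest weight representation with
`(x - s y) a(x) b(y) = (s x - y) b(y) a(x)`, `(s² x - y) a(x) a(y) = (x - s² y) a(y) a(x)` and the
same for `b`. -/
structure CurrentPair (s : ℂ) (a b : ℤ → Module.End ℂ V) : Prop where
  ne_zero : s ≠ 0
  mixed : ∀ n m u, a (n + 1) (b m u) - s • a n (b (m + 1) u) =
    s • b m (a (n + 1) u) - b (m + 1) (a n u)
  left : ∀ n m u, s ^ 2 • a (n + 1) (a m u) - a n (a (m + 1) u) =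
    a m (a (n + 1) u) - s ^ 2 • a (m + 1) (a n u)
  right : ∀ n m u, s ^ 2 • b (n + 1) (b m u) - b n (b (m + 1) u) =
    b m (b (n + 1) u) - s ^ 2 • b (m + 1) (b n u)
  bound_left : ∀ v, ∃ N : ℤ, ∀ n ≥ N, a n v = 0
  bound_right : ∀ v, ∃ N : ℤ, ∀ n ≥ N, b n v = 0

/-- The series `b(y) a(x)`. -/
def swapped (a b : ℤ → Module.End ℂ V) (n m : ℤ) (v : V) : V := b m (a n v)

/-- The continuation of `a(x) b(y)` to the region `|x| < |s y|`. -/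
def cont (s : ℂ) (a b : ℤ → Module.End ℂ V) : ℤ → ℤ → V → V :=
  seriesMul (ratio s 1 1 s) (swapped a b)

/-- The modes of the current `C(y)` with
`a(x) b(y) = C(y) δ(s y / x) + (s x - y)/(x - s y) b(y) a(x)`, `|x| < |s y|`. -/
def fused (s : ℂ) (a b : ℤ → Module.End ℂ V) (m : ℤ) (v : V) : V :=
  a 0 (b m v) - cont s a b 0 m v

namespace CurrentPair

variable {s : ℂ} {a b : ℤ → Module.End ℂ V}

theorem bound_swap {N : ℤ} {v : V} (hN : ∀ n ≥ N, a n v = 0) :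
    ∀ n ≥ N, ∀ m, swapped a b n m v = 0 := by
  intro n hn m
  rw [swapped, hN n hn, map_zero]

theorem cont_eq_zero {N : ℤ} {v : V} (hN : ∀ n ≥ N, a n v = 0) {n : ℤ} (hn : N ≤ n) (m : ℤ) :
    cont s a b n m v = 0 :=
  seriesMul_eq_zero_of_bound _ (bound_swap hN) hn m

theorem cont_rec (h : CurrentPair s a b) (n m : ℤ) (v : V) :
    cont s a b (n + 1) m v - s • cont s a b n (m + 1) v =
      s • b m (a (n + 1) v) - b (m + 1) (a n v) := by
  obtain ⟨N, hN⟩ := h.bound_left v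
  have := seriesMul_ratio (a := s) (b := 1) (c := 1) h.ne_zero (bound_swap (b := b) hN) n m
  simpa only [one_smul, swapped, cont] using this

/-- The product and its continuation satisfy the same linear equation, so their difference is killed
by x - sy. Its coefficients are then geometric along each antidiagonal, which is the delta function.
-/
theorem mul_eq (h : CurrentPair s a b) (n m : ℤ) (v : V) :
    a n (b m v) = s ^ n • fused s a b (n + m) v + cont s a b n m v := by
  set D : ℤ → ℤ → V := fun n m => a n (b m v) - cont s a b n m v with hD
  have hrec : ∀ n m, D (n + 1) m = s • D n (m + 1) := by
    intro n m
    have h1 := h.cont_rec n m v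
    have h2 := h.mixed n m v
    simp only [hD]
    linear_combination (norm := module) h2 - h1
  have key : ∀ n m, D n m = s ^ n • D 0 (n + m) := by
    intro n
    induction n using Int.induction_on with
    | zero => simp
    | succ n ih =>
      intro m
      rw [hrec, ih, smul_smul, zpow_add_one₀ h.ne_zero, mul_comm]
      congr 2
      ring
    | pred n ih =>
      intro m
      have h1 := ih (m - 1)
      have h2 := hrec (-n - 1) (m - 1)
      rw [sub_add_cancel, sub_add_cancel] at h2
      rw [h2, show s ^ (-(n : ℤ)) = s * s ^ (-(n : ℤ) - 1) by
        rw [mul_comm, ← zpow_add_one₀ h.ne_zero, sub_add_cancel], mul_smul] at h1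
      have h3 := smul_right_injective V h.ne_zero h1
      rw [h3]
      congr 2
      ring
  have := key n m
  simp only [hD] at this
  rw [fused, ← this, sub_add_cancel]

theorem fused_eq (h : CurrentPair s a b) (n m : ℤ) (v : V) :
    s ^ n • fused s a b m v = a n (b (m - n) v) - cont s a b n (m - n) v := by
  rw [h.mul_eq n (m - n) v, add_sub_cancel, add_sub_cancel_right]

theorem fused_zero (m : ℤ) : fused s a b m 0 = 0 := by
  rw [fused, cont_eq_zero (N := 0) (by simp) le_rfl]
  simp

theorem fused_bound (h : CurrentPair s a b) (v : V) :
    ∃ N : ℤ, ∀ n ≥ N, fused s a b n v = 0 := by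
  obtain ⟨N, hN⟩ := h.bound_left v
  obtain ⟨M, hM⟩ := h.bound_right v
  refine ⟨N + M, fun n hn => ?_⟩
  -- Any mode of a recovers the fused mode; the index N is chosen so that the continuation already
  -- vanishes.
  have := h.fused_eq N n v
  rw [hM _ (by omega), cont_eq_zero hN le_rfl, map_zero, sub_zero] at this
  exact (smul_eq_zero.1 this).resolve_left (zpow_ne_zero _ h.ne_zero)

theorem apply_cont_eq_zero (ξ : V →ₗ[ℂ] ℂ) {N : ℤ} (hξ : ∀ n ≤ N, ∀ v, ξ (b n v) = 0)
    (h : CurrentPair s a b) (n : ℤ) {m : ℤ} (hm : m ≤ N) (v : V) : ξ (cont s a b n m v) = 0 := by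
  obtain ⟨M, hM⟩ := h.bound_left v
  rw [cont, map_seriesMul ξ _ (bound_swap hM)]
  exact seriesMul_eq_zero _ fun k => hξ _ (by omega) _

theorem fused_restricted (h : CurrentPair s a b) {ξ : V →ₗ[ℂ] ℂ}
    (ha : ∃ N : ℤ, ∀ n ≤ N, ∀ v, ξ (a n v) = 0) (hb : ∃ N : ℤ, ∀ n ≤ N, ∀ v, ξ (b n v) = 0) :
    ∃ N : ℤ, ∀ n ≤ N, ∀ v, ξ (fused s a b n v) = 0 := by
  obtain ⟨N, hN⟩ := ha
  obtain ⟨M, hM⟩ := hb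
  refine ⟨N + M, fun n hn v => ?_⟩
  have := congrArg ξ (h.fused_eq N n v)
  rw [map_sub, hN _ le_rfl, apply_cont_eq_zero ξ hM h _ (by omega), map_smul, sub_zero] at this
  exact (smul_eq_zero.1 this).resolve_left (zpow_ne_zero _ h.ne_zero)

/-! ### Serre relations as exchange relations with the fused current -/

/-- The operator `serre` applied to a vector. -/
theorem serre_apply (q : ℂ) (x y : ℤ → Module.End ℂ V) (i j k : ℤ) (v : V) :
    serre q x y i j k v =
      (x i (x j (y k v)) - (q + q⁻¹) • x i (y k (x j v)) + y k (x i (x j v))) +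
      (x j (x i (y k v)) - (q + q⁻¹) • x j (y k (x i v)) + y k (x j (x i v))) := rfl

theorem smul_serre_apply (hs : s ≠ 0) (x y : ℤ → Module.End ℂ V) (i j k : ℤ) (v : V) :
    s • serre s x y i j k v =
      (s • x i (x j (y k v)) - (s ^ 2 + 1) • x i (y k (x j v)) + s • y k (x i (x j v))) +
      (s • x j (x i (y k v)) - (s ^ 2 + 1) • x j (y k (x i v)) + s • y k (x j (x i v))) := by
  rw [serre_apply, show s ^ 2 + 1 = s * (s + s⁻¹) by field_simp]
  module

/-- Multiplication by (x₁ - sy)(x₂ - sy) allows b to be moved to the far left. What is left of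
b(y)a(x₁)a(x₂) has coefficient (s - s⁻¹) y (s²x₁ - x₂), and its symmetrization vanishes by the
quadratic relation of a with itself. -/
theorem serre_left_rec (h : CurrentPair s a b) (i j k : ℤ) (v : V) :
    (serre s a b (i + 1) (j + 1) k v - s • serre s a b i (j + 1) (k + 1) v) -
      s • (serre s a b (i + 1) j (k + 1) v - s • serre s a b i j (k + 1 + 1) v) = 0 := by
  apply smul_right_injective V h.ne_zero
  beta_reduce
  have hS := fun i j k => smul_serre_apply h.ne_zero a b i j k v
  have e2 : ∀ i j k, a i (a (j + 1) (b k v)) - s • a i (a j (b (k + 1) v)) =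
      s • a i (b k (a (j + 1) v)) - a i (b (k + 1) (a j v)) := by
    intro i j k
    simpa only [map_sub, map_smul] using congrArg (a i) (h.mixed j k v)
  have e1 := fun i j k => h.mixed i k (a j v)
  have e0 := congrArg (b (k + 1)) (h.left i j v)
  simp only [map_sub, map_smul] at e0
  linear_combination (norm := module)
    hS (i + 1) (j + 1) k - s • hS i (j + 1) (k + 1)
    - s • (hS (i + 1) j (k + 1) - s • hS i j (k + 1 + 1))
    + s • (e2 (i + 1) j k - s • e2 i j (k + 1)) + s • (e2 (j + 1) i k - s • e2 j i (k + 1))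
    + s • (s • e1 i (j + 1) k - e1 i j (k + 1)) + s • (s • e1 j (i + 1) k - e1 j i (k + 1))
    - (s ^ 2 + 1) • (e1 i (j + 1) k - s • e1 i j (k + 1))
    - (s ^ 2 + 1) • (e1 j (i + 1) k - s • e1 j i (k + 1))
    + (s ^ 2 - 1) • e0

/-- The mirror computation: (x - sy₁)(x - sy₂) moves a to the far right, and the quadratic relation
of b with itself finishes. -/
theorem serre_right_rec (h : CurrentPair s a b) (i j k : ℤ) (v : V) :
    (serre s b a i j (k + 1 + 1) v - s • serre s b a (i + 1) j (k + 1) v) -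
      s • (serre s b a i (j + 1) (k + 1) v - s • serre s b a (i + 1) (j + 1) k v) = 0 := by
  apply smul_right_injective V h.ne_zero
  beta_reduce
  have hS := fun i j k => smul_serre_apply h.ne_zero b a i j k v
  have e2 : ∀ i j k, b i (a (k + 1) (b j v)) - s • b i (a k (b (j + 1) v)) =
      s • b i (b j (a (k + 1) v)) - b i (b (j + 1) (a k v)) := by
    intro i j k
    simpa only [map_sub, map_smul] using congrArg (b i) (h.mixed k j v)
  have e1 := fun i j k => h.mixed k i (b j v)
  have e0 := h.right j i (a (k + 1) v)
  linear_combination (norm := module)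
    hS i j (k + 1 + 1) - s • hS (i + 1) j (k + 1)
    - s • (hS i (j + 1) (k + 1) - s • hS (i + 1) (j + 1) k)
    + s • (e1 i j (k + 1) - s • e1 i (j + 1) k) + s • (e1 j i (k + 1) - s • e1 j (i + 1) k)
    + s • (s • e2 i j (k + 1) - e2 (i + 1) j k) + s • (s • e2 j i (k + 1) - e2 (j + 1) i k)
    - (s ^ 2 + 1) • (e2 i j (k + 1) - s • e2 (i + 1) j k)
    - (s ^ 2 + 1) • (e2 j i (k + 1) - s • e2 (j + 1) i k)
    + (s ^ 2 - 1) • e0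

/-- The defect of the exchange relation between `a` and the fused current. -/
def leftDefect (s : ℂ) (a b : ℤ → Module.End ℂ V) (v : V) (n m : ℤ) : V :=
  a n (fused s a b m v) -
    seriesMul (ratio s⁻¹ (s ^ 2) 1 s) (fun n' m' u => fused s a b m' (a n' u)) n m v

/-- The defect of the exchange relation between the fused current and `b`. -/
def rightDefect (s : ℂ) (a b : ℤ → Module.End ℂ V) (v : V) (n m : ℤ) : V :=
  fused s a b n (b m v) -
    seriesMul (ratio 1 (s ^ 2) s s) (fun n' m' u => b m' (fused s a b n' u)) n m v

/-- The part of `a(x₁) a(x₂) b(y) - (s + s⁻¹) a(x₁) b(y) a(x₂) + b(y) a(x₁) a(x₂)` that remains when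
the contributions of the fused current are removed. -/
def leftRemainder (s : ℂ) (a b : ℤ → Module.End ℂ V) (v : V) (i j k : ℤ) : V :=
  a i (a j (b k v)) - (s + s⁻¹) • a i (b k (a j v)) + b k (a i (a j v))
    - s ^ j • a i (fused s a b (j + k) v)
    + s ^ i • seriesMul (ratio s⁻¹ (s ^ 2) 1 s) (fun n' m' u => fused s a b m' (a n' u)) j (i + k) v

/-- The part of `b(y₁) b(y₂) a(x) - (s + s⁻¹) b(y₁) a(x) b(y₂) + a(x) b(y₁) b(y₂)` that remains when
the contributions of the fused current are removed. -/
def rightRemainder (s : ℂ) (a b : ℤ → Module.End ℂ V) (v : V) (i j k : ℤ) : V :=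
  b i (b j (a k v)) - (s + s⁻¹) • b i (a k (b j v)) + a k (b i (b j v))
    - s ^ k • fused s a b (k + i) (b j v)
    + s ^ k • seriesMul (ratio 1 (s ^ 2) s s) (fun n' m' u => b m' (fused s a b n' u)) (k + j) i v

theorem serre_left_eq_remainder (i j k : ℤ) (v : V) :
    leftRemainder s a b v i j k + leftRemainder s a b v j i k =
      serre s a b i j k v - s ^ j • leftDefect s a b v i (j + k)
        - s ^ i • leftDefect s a b v j (i + k) := by
  rw [serre_apply, leftRemainder, leftRemainder, leftDefect, leftDefect]
  module

theorem serre_right_eq_remainder (i j k : ℤ) (v : V) :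
    rightRemainder s a b v i j k + rightRemainder s a b v j i k =
      serre s b a i j k v - s ^ k • rightDefect s a b v (k + i) j
        - s ^ k • rightDefect s a b v (k + j) i := by
  rw [serre_apply, rightRemainder, rightRemainder, rightDefect, rightDefect]
  module

/-- After the fused terms cancel, only continued products remain; their rightmost factors are modes
of a, so boundedness can be read off. -/
theorem leftRemainder_eq (h : CurrentPair s a b) {v : V} {N : ℤ} (hN : ∀ n ≥ N, a n v = 0)
    {j : ℤ} {K : ℕ} (hK : N ≤ j + K) (i k : ℤ) :
    leftRemainder s a b v i j k =
      ∑ l ∈ Finset.range K,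
        PowerSeries.coeff l (ratio s 1 1 s) • cont s a b i (k - l) (a (j + l) v)
      - (s + s⁻¹) • cont s a b i k (a j v) + b k (a i (a j v)) := by
  have hb : ∀ n ≥ N, ∀ m, (fun (n' m' : ℤ) (u : V) => fused s a b m' (a n' u)) n m v = 0 :=
    fun n hn m => by simp only [hN n hn, fused_zero]
  have h1 : a i (a j (b k v)) = s ^ j • a i (fused s a b (j + k) v) +
      ∑ l ∈ Finset.range K, PowerSeries.coeff l (ratio s 1 1 s) •
        (s ^ i • fused s a b (i + k - l) (a (j + l) v) + cont s a b i (k - l) (a (j + l) v)) := by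
    rw [h.mul_eq j k v, map_add, map_smul, cont, seriesMul_eq_sum_of_bound _ (bound_swap hN) hK,
      map_sum]
    congr 1
    refine Finset.sum_congr rfl fun l _ => ?_
    rw [map_smul, swapped, h.mul_eq i, add_sub_assoc]
    rfl
  have h2 := h.mul_eq i k (a j v)
  rw [leftRemainder, ratio_eq_sub h.ne_zero, seriesMul_C_sub _ _ hb,
    seriesMul_eq_sum_of_bound _ hb hK, h1, h2]
  simp only [smul_add, Finset.sum_add_distrib, smul_sub, Finset.smul_sum]
  simp only [smul_comm _ (s ^ i)]
  module

theorem leftRemainder_eq_zero_right (h : CurrentPair s a b) {v : V} {N : ℤ}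
    (hN : ∀ n ≥ N, a n v = 0) {j : ℤ} (hj : N ≤ j) (i k : ℤ) : leftRemainder s a b v i j k = 0 := by
  rw [h.leftRemainder_eq hN (K := 0) (by simpa using hj), hN j hj,
    cont_eq_zero (N := i) (by simp) le_rfl]
  simp

theorem leftRemainder_eq_zero_left (h : CurrentPair s a b) (v : V) (j : ℤ) :
    ∃ M : ℤ, ∀ i ≥ M, ∀ k, leftRemainder s a b v i j k = 0 := by
  obtain ⟨N, hN⟩ := h.bound_left v
  choose B hB using h.bound_left
  -- For fixed j only finitely many vectors a(j + l)v are nonzero, so their bounds have a common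
  -- maximum. The range K + 1 always contains l = 0, needed for the terms outside the sum.
  set K : ℕ := (N - j).toNat
  obtain ⟨M, hM⟩ := Finset.exists_le ((Finset.range (K + 1)).image fun l : ℕ => B (a (j + l) v))
  have hM' : ∀ l ∈ Finset.range (K + 1), B (a (j + l) v) ≤ M := fun l hl =>
    hM _ (Finset.mem_image_of_mem _ hl)
  refine ⟨M, fun i hi k => ?_⟩
  have h0 : B (a j v) ≤ i := by simpa using (hM' 0 (by simp)).trans hi
  rw [h.leftRemainder_eq hN (K := K + 1) (by omega), hB _ i h0, cont_eq_zero (hB _) h0,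
    Finset.sum_eq_zero]
  · simp
  · intro l hl
    rw [cont_eq_zero (hB _) ((hM' l hl).trans hi), smul_zero]

/-- The delta terms are killed by (x₁ - sy)(x₂ - sy), so the symmetrized remainder W inherits the
recursion of the Serre expression. Boundedness in i for fixed j strips off x₁ - sy; symmetry then
gives boundedness in j, which strips off x₂ - sy. -/
theorem serre_left_eq (h : CurrentPair s a b) (i j k : ℤ) (v : V) :
    serre s a b i j k v =
      s ^ j • leftDefect s a b v i (j + k) + s ^ i • leftDefect s a b v j (i + k) := by
  set W : ℤ → ℤ → ℤ → V := fun i j k =>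
    leftRemainder s a b v i j k + leftRemainder s a b v j i k with hW
  have hb : ∀ j, ∃ M : ℤ, ∀ i ≥ M, ∀ k, W i j k = 0 := by
    intro j
    obtain ⟨N, hN⟩ := h.bound_left v
    obtain ⟨M, hM⟩ := h.leftRemainder_eq_zero_left v j
    refine ⟨max M N, fun i hi k => ?_⟩
    simp only [hW]
    rw [hM i (le_of_max_le_left hi), h.leftRemainder_eq_zero_right hN (le_of_max_le_right hi),
      add_zero]
  have hsymm : ∀ i j k, W i j k = W j i k := fun i j k => add_comm _ _
  have hrec : ∀ i j k, W (i + 1) (j + 1) k - s • W i (j + 1) (k + 1) =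
      s • (W (i + 1) j (k + 1) - s • W i j (k + 1 + 1)) := by
    intro i j k
    have h1 := h.serre_left_rec i j k v
    simp only [hW, serre_left_eq_remainder, zpow_add_one₀ h.ne_zero, add_right_comm _ (1 : ℤ),
      ← add_assoc]
    linear_combination (norm := module) h1
  have h1 : ∀ i j k, W i (j + 1) k - s • W i j (k + 1) = 0 := by
    intro i j k
    obtain ⟨M, hM⟩ := hb j
    obtain ⟨M', hM'⟩ := hb (j + 1)
    refine eq_zero_of_recursion (D := fun i k => W i (j + 1) k - s • W i j (k + 1)) (c := 1)
      (N := max M M') h.ne_zero ?_ ?_ i k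
    · intro i k
      have := hrec i j k
      linear_combination (norm := module) this
    · intro i hi k
      simp only [hM i (le_of_max_le_left hi), hM' i (le_of_max_le_right hi), smul_zero, sub_zero]
  have h2 : W i j k = 0 := by
    obtain ⟨M, hM⟩ := hb i
    refine eq_zero_of_recursion (D := fun j k => W i j k) (c := 1) (N := M) h.ne_zero ?_ ?_ j k
    · intro j k
      have := h1 i j k
      linear_combination (norm := module) this
    · intro j hj k
      simp only [hsymm i j k, hM j hj]
  simp only [hW, serre_left_eq_remainder] at h2
  linear_combination (norm := module) h2

/-- Beyond the bound of a on v, the delta term is the whole product a(x)b(y)v, and the remaining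
terms cancel by `ratio_eq_sub`. The bound is uniform in i and j. -/
theorem rightRemainder_eq_zero (h : CurrentPair s a b) {v : V} {N : ℤ}
    (hN : ∀ n ≥ N, a n v = 0) (i j : ℤ) {k : ℤ} (hk : N ≤ k) : rightRemainder s a b v i j k = 0 := by
  have hf : ∀ n ≥ k, s ^ n • fused s a b (n + j) v = a n (b j v) := by
    intro n hn
    rw [h.mul_eq n j v, cont_eq_zero hN (hk.trans hn), add_zero]
  have h1 : s ^ k • seriesMul (ratio 1 (s ^ 2) s s) (fun n' m' u => b m' (fused s a b n' u))
      (k + j) i v = seriesMul (ratio s⁻¹ (s ^ 2) 1 s) (swapped a b) k i (b j v) := by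
    rw [seriesMul, seriesMul, smul_finsum]
    refine finsum_congr fun l => ?_
    -- On the support of the delta function x equals s times the argument of C, which turns one
    -- exchange factor into the other.
    have hr := ratio_coeff_rescale (a := s⁻¹) (b := s ^ 2) (c := 1) h.ne_zero s l
    rw [inv_mul_cancel₀ h.ne_zero, one_mul] at hr
    rw [hr, swapped, ← hf (k + l) (by omega), map_smul, zpow_add₀ h.ne_zero, zpow_natCast,
      add_right_comm]
    module
  obtain ⟨M, hM⟩ := h.bound_left (b j v)
  rw [rightRemainder, h1, ratio_eq_sub h.ne_zero, seriesMul_C_sub _ _ (bound_swap hM),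
    hN k hk, h.mul_eq k i (b j v), swapped, cont]
  simp only [map_zero]
  module

/-- Here one bound in the index of a, uniform in the other two, strips off both factors x - sy₁ and
x - sy₂. -/
theorem serre_right_eq (h : CurrentPair s a b) (i j k : ℤ) (v : V) :
    serre s b a i j k v =
      s ^ k • rightDefect s a b v (k + i) j + s ^ k • rightDefect s a b v (k + j) i := by
  set W : ℤ → ℤ → ℤ → V := fun i j k =>
    rightRemainder s a b v i j k + rightRemainder s a b v j i k with hW
  obtain ⟨N, hN⟩ := h.bound_left v
  have hb : ∀ k ≥ N, ∀ i j, W i j k = 0 := by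
    intro k hk i j
    simp only [hW]
    rw [h.rightRemainder_eq_zero hN _ _ hk, h.rightRemainder_eq_zero hN _ _ hk, add_zero]
  have hrec : ∀ i j k, W i j (k + 1 + 1) - s • W (i + 1) j (k + 1) =
      s • (W i (j + 1) (k + 1) - s • W (i + 1) (j + 1) k) := by
    intro i j k
    have h1 := h.serre_right_rec i j k v
    simp only [hW, serre_right_eq_remainder, zpow_add_one₀ h.ne_zero, add_right_comm _ (1 : ℤ),
      ← add_assoc]
    linear_combination (norm := module) h1
  have h1 : ∀ i j k, W i j (k + 1) - s • W i (j + 1) k = 0 := by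
    intro i j k
    refine eq_zero_of_recursion (D := fun k i => W i j (k + 1) - s • W i (j + 1) k) (c := 1)
      (N := N) h.ne_zero ?_ ?_ k i
    · intro k i
      have := hrec i j k
      linear_combination (norm := module) this
    · intro k hk i
      simp only [hb k hk, hb (k + 1) (by omega), smul_zero, sub_zero]
  have h2 : W i j k = 0 := by
    refine eq_zero_of_recursion (D := fun k j => W i j k) (c := 1) (N := N) h.ne_zero ?_ ?_ k j
    · intro k j
      have := h1 i j k
      linear_combination (norm := module) this
    · intro k hk j
      simp only [hb k hk]
  simp only [hW, serre_right_eq_remainder] at h2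
  linear_combination (norm := module) h2

/-- The Serre relation between `a` (twice) and `b` is the exchange relation of `a` with the fused
current. -/
theorem serre_left_iff (h : CurrentPair s a b) :
    (∀ i j k, serre s a b i j k = 0) ↔
      Exchange s⁻¹ (s ^ 2) 1 s (fun n u => a n u) (fused s a b) := by
  constructor
  · intro hS n m v
    -- With equal indices the two delta terms coincide, so a single defect is isolated.
    have h1 := h.serre_left_eq n n (m - n) v
    rw [hS, LinearMap.zero_apply, add_sub_cancel, ← two_smul ℂ, smul_smul] at h1
    have := (smul_eq_zero.1 h1.symm).resolve_left
      (mul_ne_zero two_ne_zero (zpow_ne_zero _ h.ne_zero))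
    exact sub_eq_zero.1 this
  · intro hE i j k
    ext v
    rw [h.serre_left_eq, leftDefect, leftDefect, ← hE, ← hE, sub_self, sub_self]
    simp

/-- The Serre relation between `b` (twice) and `a` is the exchange relation of the fused current
with `b`. -/
theorem serre_right_iff (h : CurrentPair s a b) :
    (∀ i j k, serre s b a i j k = 0) ↔
      Exchange 1 (s ^ 2) s s (fused s a b) (fun n u => b n u) := by
  constructor
  · intro hS n m v
    have h1 := h.serre_right_eq m m (n - m) v
    rw [hS, LinearMap.zero_apply, sub_add_cancel, ← two_smul ℂ, smul_smul] at h1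
    have := (smul_eq_zero.1 h1.symm).resolve_left
      (mul_ne_zero two_ne_zero (zpow_ne_zero _ h.ne_zero))
    exact sub_eq_zero.1 this
  · intro hE i j k
    ext v
    rw [h.serre_right_eq, rightDefect, rightDefect, ← hE, ← hE, sub_self, sub_self]
    simp

end CurrentPair

end Fused

/-! ### Laurent series in two variables with complex coefficients -/

section Laurent

theorem hasSum_of_eq {β : Type*} {f g : β → ℂ} {x y : ℂ} (h : HasSum f x) (hf : ∀ p, g p = f p)
    (hx : y = x) : HasSum g y := by
  rwa [funext hf, hx]

/-- The term of the Laurent series with coefficients `T`. -/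
def laurentTerm (T : ℤ → ℤ → ℂ) (z w : ℂ) (p : ℤ × ℤ) : ℂ := T p.1 p.2 * z ^ (-p.1) * w ^ (-p.2)

/-- The Laurent polynomial with the coefficients `P n m`, `(n, m) ∈ s`. -/
def laurentPoly (s : Finset (ℤ × ℤ)) (P : ℤ → ℤ → ℂ) (z w : ℂ) : ℂ := ∑ p ∈ s, laurentTerm P z w p

theorem hasSum_laurentPoly {s : Finset (ℤ × ℤ)} {P : ℤ → ℤ → ℂ}
    (hs : ∀ p ∉ s, P p.1 p.2 = 0) (z w : ℂ) :
    HasSum (laurentTerm P z w) (laurentPoly s P z w) :=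
  hasSum_sum_of_ne_finset_zero fun p hp => by rw [laurentTerm, hs p hp, zero_mul, zero_mul]

theorem hasSum_laurent_mul {T : ℤ → ℤ → ℂ} {z w F : ℂ} (hz : z ≠ 0) (hw : w ≠ 0)
    (hT : HasSum (laurentTerm T z w) F) (c d : ℂ) :
    HasSum (laurentTerm (fun n m => c * T (n + 1) m - d * T n (m + 1)) z w)
      ((c * z - d * w) * F) := by
  have h1 := ((Equiv.addRight ((1 : ℤ), (0 : ℤ))).hasSum_iff.2 hT).mul_left (c * z)
  have h2 := ((Equiv.addRight ((0 : ℤ), (1 : ℤ))).hasSum_iff.2 hT).mul_left (d * w)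
  rw [sub_mul]
  refine hasSum_of_eq (h1.sub h2) (fun ⟨n, m⟩ => ?_) rfl
  simp only [laurentTerm, Function.comp_apply, Equiv.coe_addRight, Prod.mk_add_mk, add_zero, neg_add,
    zpow_add₀ hz, zpow_add₀ hw, zpow_neg_one]
  field_simp

/-- The expansion of `z^{-i} w^{-j} / (c z - d w)` in the region `|d w| < |c z|`. -/
def elementary (c d : ℂ) (i j n m : ℤ) : ℂ :=
  if n + m = i + j + 1 ∧ i < n then c⁻¹ * (d / c) ^ (n - i - 1) else 0

theorem elementary_rec {c d : ℂ} (hc : c ≠ 0) (hd : d ≠ 0) (i j n m : ℤ) :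
    c * elementary c d i j (n + 1) m - d * elementary c d i j n (m + 1) =
      if (n, m) = (i, j) then 1 else 0 := by
  have hdc : d / c ≠ 0 := div_ne_zero hd hc
  simp only [elementary, Prod.mk.injEq]
  by_cases h1 : n + m = i + j
  · by_cases h2 : i < n
    · rw [if_pos ⟨by omega, by omega⟩, if_pos ⟨by omega, h2⟩, if_neg (by omega),
        show n + 1 - i - 1 = n - i - 1 + 1 by ring, zpow_add_one₀ hdc]
      field_simp
      ring
    · by_cases h3 : n = i
      · subst h3
        rw [if_pos ⟨by omega, by omega⟩, if_neg (by omega), if_pos ⟨rfl, by omega⟩]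
        simp [hc]
      · rw [if_neg (by omega), if_neg (by omega), if_neg (by omega)]
        simp
  · rw [if_neg (by omega), if_neg (by omega), if_neg (by omega)]
    simp

theorem hasSum_elementary {c d z w : ℂ} (hc : c ≠ 0) (hz : z ≠ 0) (hw : w ≠ 0)
    (hlt : ‖d * w‖ < ‖c * z‖) (i j : ℤ) :
    HasSum (laurentTerm (elementary c d i j) z w) (z ^ (-i) * w ^ (-j) / (c * z - d * w)) := by
  have hcz : c * z ≠ 0 := mul_ne_zero hc hz
  have hne : c * z - d * w ≠ 0 := by
    intro h
    rw [sub_eq_zero.1 h] at hlt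
    exact lt_irrefl _ hlt
  have hg : HasSum (fun k : ℕ => (d * w / (c * z)) ^ k) (1 - d * w / (c * z))⁻¹ := by
    apply hasSum_geometric_of_norm_lt_one
    rw [norm_div, div_lt_one (norm_pos_iff.2 hcz)]
    exact hlt
  have hinj : Function.Injective fun k : ℕ => ((i + 1 + k, j - k) : ℤ × ℤ) := by
    intro k l h
    simp only [Prod.mk.injEq] at h
    omega
  rw [← hinj.hasSum_iff]
  · refine hasSum_of_eq (hg.mul_left (z ^ (-i) * w ^ (-j) / (c * z))) (fun k => ?_) ?_
    · simp only [Function.comp_apply, laurentTerm, elementary]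
      rw [if_pos ⟨by ring, by omega⟩, show i + 1 + (k : ℤ) - i - 1 = k by ring,
        show -(i + 1 + (k : ℤ)) = -i + -1 + -k by ring, show -(j - (k : ℤ)) = -j + k by ring,
        zpow_add₀ hz, zpow_add₀ hz, zpow_add₀ hw, zpow_natCast, zpow_neg z k, zpow_natCast,
        zpow_natCast, zpow_neg_one, div_pow, div_pow, mul_pow, mul_pow]
      field_simp
    · rw [show 1 - d * w / (c * z) = (c * z - d * w) / (c * z) by field_simp]
      field_simp
  · rintro ⟨n, m⟩ hnm
    rw [laurentTerm, elementary, if_neg, zero_mul, zero_mul]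
    rintro ⟨h1, h2⟩
    refine hnm ⟨(n - i - 1).toNat, ?_⟩
    simp only [Prod.mk.injEq] at h1 h2 ⊢
    omega

variable {T P : ℤ → ℤ → ℂ} {c d : ℂ} {s : Finset (ℤ × ℤ)} {N : ℤ}

/-- A solution of `(c z - d w) T = P` whose powers of `z` are bounded above. -/
theorem eq_sum_elementary (hc : c ≠ 0) (hd : d ≠ 0)
    (hT : ∀ n m, c * T (n + 1) m - d * T n (m + 1) = P n m) (hs : ∀ p ∉ s, P p.1 p.2 = 0)
    (hN : ∀ n ≤ N, ∀ m, T n m = 0) (n m : ℤ) :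
    T n m = ∑ p ∈ s, P p.1 p.2 * elementary c d p.1 p.2 n m := by
  obtain ⟨N', hN'⟩ := Finset.exists_le (s.image fun p => -p.1)
  have hs' : ∀ p ∈ s, -p.1 ≤ N' := fun p hp => hN' _ (Finset.mem_image_of_mem _ hp)
  set D : ℤ → ℤ → ℂ := fun n m => T n m - ∑ p ∈ s, P p.1 p.2 * elementary c d p.1 p.2 n m with hD
  have hsum : ∀ n m, ∑ p ∈ s, P p.1 p.2 * (if (n, m) = (p.1, p.2) then (1 : ℂ) else 0) = P n m := by
    intro n m
    simp only [Prod.mk.eta, mul_ite, mul_one, mul_zero]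
    rw [Finset.sum_ite_eq]
    split_ifs with h
    · rfl
    · exact (hs _ h).symm
  have hrec : ∀ n m, c * D (n + 1) m = d * D n (m + 1) := by
    intro n m
    have h1 := hsum n m
    simp only [← elementary_rec hc hd, mul_sub, Finset.sum_sub_distrib] at h1
    simp only [hD, mul_sub, Finset.mul_sum, mul_left_comm c, mul_left_comm d]
    linear_combination hT n m - h1
  -- Reversing the signs of the indices turns vanishing for small n into vanishing for large n, and
  -- exchanges the roles of c and d.
  have h0 := eq_zero_of_recursion (D := fun n m => D (-n) (-m)) (c := d) (d := c)
    (N := max (-N) N') hc ?_ ?_ (-n) (-m)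
  · simp only [neg_neg, hD] at h0
    exact sub_eq_zero.1 h0
  · intro n m
    have := hrec (-(n + 1)) (-(m + 1))
    simp only [neg_add, neg_add_cancel_right] at this
    simp only [neg_add, smul_eq_mul]
    exact this.symm
  · intro n hn m
    simp only [hD]
    rw [hN _ (by have := le_of_max_le_left hn; omega), Finset.sum_eq_zero, sub_zero]
    intro p hp
    have h1 := hs' p hp
    have h2 := le_of_max_le_right hn
    rw [elementary, if_neg (by omega), mul_zero]

theorem hasSum_of_rec (hc : c ≠ 0) (hd : d ≠ 0)
    (hT : ∀ n m, c * T (n + 1) m - d * T n (m + 1) = P n m) (hs : ∀ p ∉ s, P p.1 p.2 = 0)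
    (hN : ∀ n ≤ N, ∀ m, T n m = 0) {z w : ℂ} (hz : z ≠ 0) (hw : w ≠ 0)
    (hlt : ‖d * w‖ < ‖c * z‖) :
    HasSum (laurentTerm T z w) (laurentPoly s P z w / (c * z - d * w)) := by
  have h1 := hasSum_sum fun (p : ℤ × ℤ) (_ : p ∈ s) =>
    (hasSum_elementary hc hz hw hlt p.1 p.2).mul_left (P p.1 p.2)
  refine hasSum_of_eq h1 (fun ⟨n, m⟩ => ?_) ?_
  · rw [laurentTerm, eq_sum_elementary hc hd hT hs hN, Finset.sum_mul, Finset.sum_mul]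
    exact Finset.sum_congr rfl fun p _ => by rw [laurentTerm]; ring
  · rw [laurentPoly, Finset.sum_div]
    exact Finset.sum_congr rfl fun p _ => by rw [laurentTerm]; ring

/-- `hasSum_of_rec` in the region where the second variable dominates. -/
theorem hasSum_of_rec' (hc : c ≠ 0) (hd : d ≠ 0)
    (hT : ∀ n m, c * T (n + 1) m - d * T n (m + 1) = P n m) (hs : ∀ p ∉ s, P p.1 p.2 = 0)
    (hN : ∀ m ≤ N, ∀ n, T n m = 0) {z w : ℂ} (hz : z ≠ 0) (hw : w ≠ 0)
    (hlt : ‖c * z‖ < ‖d * w‖) :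
    HasSum (laurentTerm T z w) (laurentPoly s P z w / (c * z - d * w)) := by
  have h1 := hasSum_of_rec (T := fun m n => T n m) (P := fun m n => -P n m)
    (s := s.map (Equiv.prodComm ℤ ℤ).toEmbedding) hd hc (fun m n => by rw [← hT]; ring)
    (fun p hp => by
      rw [hs (p.2, p.1), neg_zero]
      intro h
      exact hp (Finset.mem_map.2 ⟨_, h, rfl⟩)) hN hw hz hlt
  rw [← (Equiv.prodComm ℤ ℤ).hasSum_iff] at h1
  refine hasSum_of_eq h1 (fun ⟨n, m⟩ => ?_) ?_
  · simp only [laurentTerm, Function.comp_apply, Equiv.prodComm_apply, Prod.swap_prod_mk]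
    ring
  · rw [laurentPoly, laurentPoly, Finset.sum_map, ← neg_sub (d * w), div_neg, ← neg_div,
      ← Finset.sum_neg_distrib]
    congr 1
    refine Finset.sum_congr rfl fun p _ => ?_
    simp only [laurentTerm, Equiv.coe_toEmbedding, Equiv.prodComm_apply, Prod.fst_swap,
      Prod.snd_swap]
    ring

theorem analyticAt_laurentPoly (s : Finset (ℤ × ℤ)) (P : ℤ → ℤ → ℂ) {p : ℂ × ℂ} (h1 : p.1 ≠ 0)
    (h2 : p.2 ≠ 0) : AnalyticAt ℂ (fun p : ℂ × ℂ => laurentPoly s P p.1 p.2) p := by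
  simp only [laurentPoly, laurentTerm]
  apply Finset.analyticAt_fun_sum
  intro k _
  exact (analyticAt_const.mul (analyticAt_fst.zpow h1)).mul (analyticAt_snd.zpow h2)

/-! ### Uniqueness of Laurent coefficients -/

/-- Absolute summability gives uniform convergence on the circle, hence convergence in L², where
pairing with the n-th Fourier monomial extracts the coefficient. -/
theorem eq_zero_of_fourier_hasSum {h : ℤ → ℂ} (hsum : Summable h)
    (h0 : ∀ u : Circle, HasSum (fun n => h n * (u : ℂ) ^ n) 0) (n : ℤ) : h n = 0 := by
  have : Fact (0 < 2 * π) := ⟨Real.two_pi_pos⟩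
  have hs : Summable fun n => h n • (fourier n : C(AddCircle (2 * π), ℂ)) := by
    apply Summable.of_norm
    simpa only [norm_smul, fourier_norm, mul_one] using hsum.norm
  have hS : HasSum (fun n => h n • (fourier n : C(AddCircle (2 * π), ℂ))) 0 := by
    convert hs.hasSum
    ext x
    have h1 := (ContinuousMap.evalCLM ℂ x).hasSum hs.hasSum
    have h2 := h0 (AddCircle.toCircle x)
    refine h2.unique (hasSum_of_eq h1 (fun n => ?_) rfl)
    simp [fourier_apply, AddCircle.toCircle_zsmul]
  have hL := (ContinuousMap.toLp (E := ℂ) 2 (AddCircle.haarAddCircle (T := 2 * π)) ℂ).hasSum hS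
  have hI := (innerSL ℂ (fourierLp (T := 2 * π) 2 n)).hasSum hL
  rw [map_zero, map_zero] at hI
  refine (hI.unique ?_).symm
  have h3 : ∀ m, innerSL ℂ (fourierLp (T := 2 * π) 2 n)
      (ContinuousMap.toLp (E := ℂ) 2 (AddCircle.haarAddCircle (T := 2 * π)) ℂ
        (h m • (fourier m : C(AddCircle (2 * π), ℂ)))) = if m = n then h n else 0 := by
    intro m
    rw [map_smul, map_smul, innerSL_apply_apply]
    have := orthonormal_iff_ite.1 (orthonormal_fourier (T := 2 * π)) n m
    rw [fourierLp, fourierLp] at this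
    rw [fourierLp, this]
    rcases eq_or_ne m n with rfl | hne
    · simp
    · rw [if_neg hne.symm, if_neg hne, smul_zero]
  simp only [h3]
  exact hasSum_ite_eq n (h n)

theorem laurent_coeff_eq_zero {h : ℤ → ℤ → ℂ} {r₁ r₂ : ℝ} (hr₁ : 0 < r₁) (hr₂ : 0 < r₂)
    (h0 : ∀ z w : ℂ, ‖z‖ = r₁ → ‖w‖ = r₂ → HasSum (laurentTerm h z w) 0) (n m : ℤ) :
    h n m = 0 := by
  have hr₁' : (r₁ : ℂ) ≠ 0 := by exact_mod_cast hr₁.ne'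
  have hr₂' : (r₂ : ℂ) ≠ 0 := by exact_mod_cast hr₂.ne'
  set g : ℤ × ℤ → ℂ := fun p => h p.1 p.2 * (r₁ : ℂ) ^ (-p.1) * (r₂ : ℂ) ^ (-p.2) with hg
  have hgs : ∀ u t : Circle, HasSum (fun p : ℤ × ℤ => g p * (u : ℂ) ^ p.1 * (t : ℂ) ^ p.2) 0 := by
    intro u t
    have := h0 (r₁ * (u⁻¹ : Circle)) (r₂ * (t⁻¹ : Circle)) (by rw [norm_mul, Circle.norm_coe]; simp [abs_of_pos hr₁])
      (by rw [norm_mul, Circle.norm_coe]; simp [abs_of_pos hr₂])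
    refine hasSum_of_eq this (fun p => ?_) rfl
    simp only [hg, laurentTerm, Circle.coe_inv, mul_zpow, inv_zpow', neg_neg]
    ring
  have hsumm : Summable g := by simpa using (hgs 1 1).summable
  -- The one-variable uniqueness is applied twice, first in u with t fixed, then in t.
  have h1 : ∀ (t : Circle) (k : ℤ), HasSum (fun l => g (k, l) * (t : ℂ) ^ l) 0 := by
    intro t k
    have hst : Summable fun p : ℤ × ℤ => g p * (t : ℂ) ^ p.2 := by simpa using (hgs 1 t).summable
    have hrow : ∀ k, Summable fun l => g (k, l) * (t : ℂ) ^ l := fun k => hst.prod_factor k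
    have := eq_zero_of_fourier_hasSum (h := fun k => ∑' l, g (k, l) * (t : ℂ) ^ l) hst.prod ?_ k
    · exact hasSum_of_eq (hrow k).hasSum (fun _ => rfl) this.symm
    · intro u
      refine (hgs u t).prod_fiberwise fun k => ?_
      exact hasSum_of_eq ((hrow k).hasSum.mul_right ((u : ℂ) ^ k)) (fun l => by ring) rfl
  have h2 := eq_zero_of_fourier_hasSum (h := fun l => g (n, l)) (hsumm.prod_factor n)
    (fun t => h1 t n) m
  simp only [hg] at h2
  simpa [hr₁', hr₂', zpow_ne_zero] using h2

end Laurent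

section Analytic

variable {V : Type*} [AddCommGroup V] [Module ℂ V]

/-! ### Formal and analytic exchange relations -/

/-- A current on a highest weight representation, compatible with the restricted functional `ξ`. -/
structure IsFieldFor (ξ : V →ₗ[ℂ] ℂ) (X : ℤ → V → V) : Prop where
  map_zero : ∀ n, X n 0 = 0
  bound : ∀ v, ∃ N : ℤ, ∀ n ≥ N, X n v = 0
  restricted : ∃ N : ℤ, ∀ n ≤ N, ∀ v, ξ (X n v) = 0

variable {a b c d : ℂ} {X Y : ℤ → V → V} {ξ : V →ₗ[ℂ] ℂ}

/-- The left side bounds n from below and m from above, the right side n from above and m from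
below. So X(z)Y(w) is a Laurent polynomial in matrix coefficients, and Y(w)X(z) is (cz - dw) times
it, divided by az - bw. -/
theorem analyticExchange_of_exchange (ha : a ≠ 0) (hb : b ≠ 0) (hd : d ≠ 0)
    (hX : IsFieldFor ξ X) (hY : IsFieldFor ξ Y) (hE : Exchange a b c d X Y) (v : V) :
    AnalyticExchange a b c d X Y ξ v := by
  obtain ⟨N₁, hN₁⟩ := hX.restricted
  obtain ⟨N₂, hN₂⟩ := hX.bound v
  obtain ⟨M₁, hM₁⟩ := hY.restricted
  obtain ⟨M₂, hM₂⟩ := hY.bound v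
  set T : ℤ → ℤ → ℂ := fun n m => ξ (X n (Y m v)) with hT
  set U : ℤ → ℤ → ℂ := fun n m => ξ (Y m (X n v)) with hU
  have hbd : ∀ n ≥ N₂, ∀ m, (fun (n' m' : ℤ) (u : V) => Y m' (X n' u)) n m v = 0 :=
    fun n hn m => by simp only [hN₂ n hn, hY.map_zero]
  have hUb : ∀ n ≥ N₂, ∀ m, (fun (n' m' : ℤ) (_ : ℂ) => U n' m') n m 0 = 0 :=
    fun n hn m => by simp only [hU, hN₂ n hn, hY.map_zero, map_zero]
  have hTU : ∀ n m, T n m = seriesMul (ratio a b c d) (fun n' m' (_ : ℂ) => U n' m') n m 0 := by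
    intro n m
    simp only [hT]
    rw [hE, map_seriesMul ξ _ hbd]
  have hrec : ∀ n m, a * U (n + 1) m - b * U n (m + 1) = c * T (n + 1) m - d * T n (m + 1) := by
    intro n m
    rw [hTU, hTU]
    exact (seriesMul_ratio (S := fun n' m' (_ : ℂ) => U n' m') hd hUb n m).symm
  have hT₁ : ∀ n ≤ N₁, ∀ m, T n m = 0 := fun n hn m => hN₁ n hn _
  have hT₂ : ∀ n ≥ N₂, ∀ m, T n m = 0 := fun n hn m => by
    rw [hTU, seriesMul_eq_zero_of_bound _ hUb hn]
  have hT₃ : ∀ m ≤ M₁, ∀ n, T n m = 0 := fun m hm n => by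
    rw [hTU]
    exact seriesMul_eq_zero _ fun k => hM₁ _ (by omega) _
  have hT₄ : ∀ m ≥ M₂, ∀ n, T n m = 0 := fun m hm n => by
    simp only [hT]
    rw [hM₂ m hm, hX.map_zero, map_zero]
  set P : ℤ → ℤ → ℂ := fun n m => c * T (n + 1) m - d * T n (m + 1) with hP
  -- The lower ends are enlarged by one because P involves the shifted coefficients of T; the same
  -- box then serves both.
  set s : Finset (ℤ × ℤ) := Finset.Icc (N₁ - 1) N₂ ×ˢ Finset.Icc (M₁ - 1) M₂ with hs
  have hmem : ∀ p ∉ s, p.1 ≤ N₁ - 1 ∨ N₂ ≤ p.1 ∨ p.2 ≤ M₁ - 1 ∨ M₂ ≤ p.2 := by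
    intro p hp
    simp only [hs, Finset.mem_product, Finset.mem_Icc] at hp
    omega
  have hTs : ∀ p ∉ s, T p.1 p.2 = 0 := by
    intro p hp
    rcases hmem p hp with h | h | h | h
    exacts [hT₁ _ (by omega) _, hT₂ _ h _, hT₃ _ (by omega) _, hT₄ _ h _]
  have hPs : ∀ p ∉ s, P p.1 p.2 = 0 := by
    intro p hp
    simp only [hP]
    rcases hmem p hp with h | h | h | h
    · rw [hT₁ _ (by omega), hT₁ _ (by omega)]; ring
    · rw [hT₂ _ (by omega), hT₂ _ (by omega)]; ring
    · rw [hT₃ _ (by omega), hT₃ _ (by omega)]; ring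
    · rw [hT₄ _ (by omega), hT₄ _ (by omega)]; ring
  refine ⟨fun p => laurentPoly s T p.1 p.2,
    fun p => laurentPoly s P p.1 p.2 / (a * p.1 - b * p.2), ?_, ?_, ?_, ?_, ?_⟩
  · rintro p ⟨h1, h2⟩
    exact analyticAt_laurentPoly s T h1 h2
  · rintro p ⟨h1, h2, h3⟩
    exact (analyticAt_laurentPoly s P h1 h2).div
      ((analyticAt_const.mul analyticAt_fst).sub (analyticAt_const.mul analyticAt_snd))
      (sub_ne_zero.2 h3)
  · intro z w _ _
    exact hasSum_laurentPoly hTs z w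
  · intro z w hz hw hlt
    exact hasSum_of_rec' (T := U) ha hb hrec hPs (fun m hm n => hM₁ m hm _) hz hw hlt
  · intro z w hz hw h1 h2
    have h3 := (hasSum_laurentPoly hPs z w).unique
      (hasSum_laurent_mul hz hw (hasSum_laurentPoly hTs z w) c d)
    have h1' := sub_ne_zero.2 h1
    have h2' := sub_ne_zero.2 h2
    simp only
    rw [h3]
    generalize a * z - b * w = A at h1' ⊢
    generalize c * z - d * w = B at h2' ⊢
    field_simp

/-- Comparing coefficients on a torus gives (cz - dw)X(z)Y(w) = (az - bw)Y(w)X(z). So X(z)Y(w)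
differs from the prescribed expansion by something supported on cz = dw, and global convergence
forces this to vanish. -/
theorem apply_eq_of_analyticExchange (ha : a ≠ 0) (hb : b ≠ 0) (hc : c ≠ 0) (hd : d ≠ 0)
    (hX : IsFieldFor ξ X) (hY : IsFieldFor ξ Y) {v : V} (hE : AnalyticExchange a b c d X Y ξ v)
    (n m : ℤ) : ξ (X n (Y m v)) =
      ξ (seriesMul (ratio a b c d) (fun n' m' u => Y m' (X n' u)) n m v) := by
  obtain ⟨N, hN⟩ := hX.bound v
  obtain ⟨F, G, -, -, hF, hG, hFG⟩ := hE
  set T : ℤ → ℤ → ℂ := fun n m => ξ (X n (Y m v)) with hT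
  set U : ℤ → ℤ → ℂ := fun n m => ξ (Y m (X n v)) with hU
  have hbd : ∀ n ≥ N, ∀ m, (fun (n' m' : ℤ) (u : V) => Y m' (X n' u)) n m v = 0 :=
    fun n hn m => by simp only [hN n hn, hY.map_zero]
  set R : ℤ → ℤ → ℂ := fun n m =>
    ξ (seriesMul (ratio a b c d) (fun n' m' u => Y m' (X n' u)) n m v) with hR
  have hRrec : ∀ n m, c * R (n + 1) m - d * R n (m + 1) = a * U (n + 1) m - b * U n (m + 1) := by
    intro n m
    have := congrArg ξ (seriesMul_ratio (a := a) (b := b) (c := c)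
      (S := fun n' m' u => Y m' (X n' u)) hd hbd n m)
    simpa only [map_sub, map_smul, smul_eq_mul] using this
  -- The torus ‖z‖ = r, ‖w‖ = 1 lies where Y(w)X(z) converges and avoids both lines az = bw and cz =
  -- dw.
  obtain ⟨r, hr, hr1, hr2⟩ : ∃ r : ℝ, 0 < r ∧ ‖a‖ * r < ‖b‖ ∧ ‖c‖ * r < ‖d‖ := by
    have h1 := norm_pos_iff.2 ha
    have h2 := norm_pos_iff.2 hb
    have h3 := norm_pos_iff.2 hc
    have h4 := norm_pos_iff.2 hd
    obtain ⟨r, hr, hlt⟩ := exists_between (lt_min (div_pos h2 h1) (div_pos h4 h3))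
    exact ⟨r, hr, by rw [mul_comm]; exact (lt_div_iff₀ h1).1 (hlt.trans_le (min_le_left _ _)),
      by rw [mul_comm]; exact (lt_div_iff₀ h3).1 (hlt.trans_le (min_le_right _ _))⟩
  have hTrec : ∀ n m, c * T (n + 1) m - d * T n (m + 1) = a * U (n + 1) m - b * U n (m + 1) := by
    intro n m
    rw [← sub_eq_zero]
    refine laurent_coeff_eq_zero (h := fun n m => c * T (n + 1) m - d * T n (m + 1) -
      (a * U (n + 1) m - b * U n (m + 1))) hr one_pos (fun z w hz hw => ?_) n m
    have hz0 : z ≠ 0 := norm_pos_iff.1 (hz ▸ hr)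
    have hw0 : w ≠ 0 := norm_pos_iff.1 (hw ▸ one_pos)
    have hlt : ‖a * z‖ < ‖b * w‖ := by rwa [norm_mul, norm_mul, hz, hw, mul_one]
    have hlt' : ‖c * z‖ < ‖d * w‖ := by rwa [norm_mul, norm_mul, hz, hw, mul_one]
    have h1 : a * z ≠ b * w := fun h => by rw [h] at hlt; exact lt_irrefl _ hlt
    have h2 : c * z ≠ d * w := fun h => by rw [h] at hlt'; exact lt_irrefl _ hlt'
    have h3 := hasSum_laurent_mul (T := T) hz0 hw0 (hF z w hz0 hw0) c d
    have h4 := hasSum_laurent_mul (T := U) hz0 hw0 (hG z w hz0 hw0 hlt) a b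
    refine hasSum_of_eq (h3.sub h4) (fun p => by simp only [laurentTerm]; ring) ?_
    rw [hFG z w hz0 hw0 h1 h2, ← mul_assoc, mul_div_cancel₀ _ (sub_ne_zero.2 h2), sub_self]
  set D : ℤ → ℤ → ℂ := fun n m => T n m - R n m with hD
  have hDrec : ∀ n m, D (n + 1) m = d / c * D n (m + 1) := by
    intro n m
    rw [div_mul_eq_mul_div, eq_div_iff hc]
    simp only [hD]
    linear_combination hTrec n m - hRrec n m
  have hgeom : ∀ k : ℕ, D (n + k) (m - k) = (d / c) ^ k * D n m := by
    intro k
    induction k with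
    | zero => simp
    | succ k ih =>
      have := hDrec (n + k) (m - (k + 1 : ℕ))
      rw [show m - ((k + 1 : ℕ) : ℤ) + 1 = m - k by push_cast; ring, ih] at this
      rw [Nat.cast_succ, ← add_assoc, ← Nat.cast_succ, this, pow_succ]
      ring
  have hinj : Function.Injective fun k : ℕ => ((n + k, m - k) : ℤ × ℤ) := by
    intro k l h
    simp only [Prod.mk.injEq] at h
    omega
  -- The point (z, w) = (d, c) lies on the pole. There the terms along the antidiagonal through (n,
  -- m) are eventually constant, equal to a nonzero multiple of D n m, yet they tend to zero.
  have hlim := ((hF d c hd hc).summable.comp_injective hinj).tendsto_atTop_zero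
  have hconst : ∀ᶠ k : ℕ in Filter.atTop, ((fun p : ℤ × ℤ => ξ (X p.1 (Y p.2 v)) * d ^ (-p.1) *
      c ^ (-p.2)) ∘ fun k : ℕ => ((n + k, m - k) : ℤ × ℤ)) k = D n m * d ^ (-n) * c ^ (-m) := by
    filter_upwards [Filter.eventually_ge_atTop (N - n).toNat] with k hk
    have hRk : R (n + k) (m - k) = 0 := by
      simp only [hR]
      rw [seriesMul_eq_zero_of_bound _ hbd (by omega), map_zero]
    have hTk : ξ (X (n + k) (Y (m - k) v)) = (d / c) ^ k * D n m := by
      rw [← hgeom k]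
      simp only [hD, hRk, hT, sub_zero]
    simp only [Function.comp_apply]
    rw [hTk, show -(n + (k : ℤ)) = -n + -k by ring, show -(m - (k : ℤ)) = -m + k by ring,
      zpow_add₀ hd, zpow_add₀ hc, zpow_neg d k, zpow_natCast, zpow_natCast, div_pow]
    field_simp
  have h0 := tendsto_nhds_unique (tendsto_const_nhds.congr' (hconst.mono fun _ h => h.symm)) hlim
  have h1 : D n m = 0 := by
    simpa [hd, hc, zpow_ne_zero] using h0
  exact sub_eq_zero.1 h1

theorem equivalentToExchange {ι : Type*} [DecidableEq ι] {A : Matrix ι ι ℤ} {q : ℂ}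
    {ρ : Alg A q →ₐ[ℂ] Module.End ℂ V} {S : Prop} (ha : a ≠ 0) (hb : b ≠ 0) (hc : c ≠ 0)
    (hd : d ≠ 0) (hX : ∀ ξ, IsRestricted ρ ξ → IsFieldFor ξ X)
    (hY : ∀ ξ, IsRestricted ρ ξ → IsFieldFor ξ Y) (hS : S ↔ Exchange a b c d X Y) :
    EquivalentToExchange ρ S a b c d X Y := by
  refine ⟨hS, fun h ξ v hξ =>
    analyticExchange_of_exchange ha hb hd (hX ξ hξ) (hY ξ hξ) (hS.1 h) v, fun hsep h => ?_⟩
  refine hS.2 fun n m v => sub_eq_zero.1 (hsep _ fun ξ hξ => ?_)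
  rw [map_sub, sub_eq_zero]
  exact apply_eq_of_analyticExchange ha hb hc hd (hX ξ hξ) (hY ξ hξ) (h ξ v hξ) n m

/-! ### Rescaling of currents -/

theorem IsFieldFor.rescale (hX : IsFieldFor ξ X) (σ : ℤ → ℂ) :
    IsFieldFor ξ fun n v => σ n • X n v := by
  refine ⟨fun n => by simp only [hX.map_zero, smul_zero], fun v => ?_, ?_⟩
  · obtain ⟨N, hN⟩ := hX.bound v
    exact ⟨N, fun n hn => by simp only [hN n hn, smul_zero]⟩
  · obtain ⟨N, hN⟩ := hX.restricted
    exact ⟨N, fun n hn v => by rw [map_smul, hN n hn, smul_zero]⟩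

/-- Multiplying the modes by σ τ^m replaces Y(w) by σY(w/τ); the substitution w → τw is absorbed in
the coefficients of z. -/
theorem exchange_rescale_right (f : ℤ → Module.End ℂ V) (Y : ℤ → V → V) {σ τ : ℂ} (hσ : σ ≠ 0)
    (hτ : τ ≠ 0) (hd : d ≠ 0) :
    Exchange a b c d (fun n u => f n u) (fun m v => (σ * τ ^ m) • Y m v) ↔
      Exchange (a * τ⁻¹) b (c * τ⁻¹) d (fun n u => f n u) Y := by
  refine forall_congr' fun n => forall_congr' fun m => forall_congr' fun v => ?_
  have hne : σ * τ ^ m ≠ 0 := mul_ne_zero hσ (zpow_ne_zero _ hτ)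
  have h1 : seriesMul (ratio a b c d) (fun n' m' u => (σ * τ ^ m') • Y m' (f n' u)) n m v =
      (σ * τ ^ m) • seriesMul (ratio (a * τ⁻¹) b (c * τ⁻¹) d) (fun n' m' u => Y m' (f n' u)) n m v := by
    rw [seriesMul, seriesMul, smul_finsum]
    refine finsum_congr fun k => ?_
    rw [ratio_coeff_rescale hd, zpow_sub₀ hτ, zpow_natCast, inv_pow, smul_smul, smul_smul]
    congr 1
    ring
  refine (Eq.congr (map_smul (f n) _ _) rfl).trans ?_
  exact (Eq.congr_right h1).trans (smul_right_injective V hne).eq_iff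

theorem exchange_rescale_left (X : ℤ → V → V) (f : ℤ → Module.End ℂ V) {σ τ : ℂ} (hσ : σ ≠ 0)
    (hτ : τ ≠ 0) (hd : d ≠ 0) :
    Exchange a b c d (fun n v => (σ * τ ^ n) • X n v) (fun n u => f n u) ↔
      Exchange (a * τ) b (c * τ) d X (fun n u => f n u) := by
  refine forall_congr' fun n => forall_congr' fun m => forall_congr' fun v => ?_
  have hne : σ * τ ^ n ≠ 0 := mul_ne_zero hσ (zpow_ne_zero _ hτ)
  have h1 : seriesMul (ratio a b c d) (fun n' m' u => f m' ((σ * τ ^ n') • X n' u)) n m v =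
      (σ * τ ^ n) • seriesMul (ratio (a * τ) b (c * τ) d) (fun n' m' u => f m' (X n' u)) n m v := by
    rw [seriesMul, seriesMul, smul_finsum]
    refine finsum_congr fun k => ?_
    rw [ratio_coeff_rescale hd, map_smul, zpow_add₀ hτ, zpow_natCast, smul_smul, smul_smul]
    congr 1
    ring
  exact (Eq.congr_right h1).trans (smul_right_injective V hne).eq_iff

theorem exchange_homogeneous (X Y : ℤ → V → V) (hd : d ≠ 0) {t : ℂ} (ht : t ≠ 0) :
    Exchange (t * a) (t * b) (t * c) (t * d) X Y ↔ Exchange a b c d X Y := by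
  rw [Exchange, ratio_homogeneous hd ht, Exchange]

/-! ### Matrix coefficients of products and of the fused current -/

/-- P is the matrix coefficient of either side of the quadratic relation, whose two forms together
bound its support in all directions. Dividing by x - sy gives both expansions, and the fused current
is the residue. -/
theorem CurrentPair.matrixCoeff {s : ℂ} {a b : ℤ → Module.End ℂ V} (h : CurrentPair s a b)
    (ha : ∃ N : ℤ, ∀ n ≤ N, ∀ v, ξ (a n v) = 0) (hb : ∃ N : ℤ, ∀ n ≤ N, ∀ v, ξ (b n v) = 0) (v : V) :
    ∃ (S : Finset (ℤ × ℤ)) (P : ℤ → ℤ → ℂ),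
      (∀ x y : ℂ, x ≠ 0 → y ≠ 0 → ‖s * y‖ < ‖x‖ →
        HasSum (laurentTerm (fun n m => ξ (a n (b m v))) x y) (laurentPoly S P x y / (x - s * y))) ∧
      (∀ x y : ℂ, x ≠ 0 → y ≠ 0 → ‖x‖ < ‖s * y‖ →
        HasSum (laurentTerm (fun n m => ξ (cont s a b n m v)) x y)
          (laurentPoly S P x y / (x - s * y))) ∧
      ∀ y : ℂ, y ≠ 0 → HasSum (fun n : ℤ => ξ (fused s a b n v) * y ^ (-n))
        (laurentPoly S P (s * y) y / (s * y)) := by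
  obtain ⟨N₁, hN₁⟩ := ha
  obtain ⟨N₂, hN₂⟩ := h.bound_left v
  obtain ⟨M₁, hM₁⟩ := hb
  obtain ⟨M₂, hM₂⟩ := h.bound_right v
  have hs := h.ne_zero
  set T : ℤ → ℤ → ℂ := fun n m => ξ (a n (b m v)) with hT
  set P : ℤ → ℤ → ℂ := fun n m => T (n + 1) m - s * T n (m + 1) with hP
  set S : Finset (ℤ × ℤ) := Finset.Icc (N₁ - 1) N₂ ×ˢ Finset.Icc (M₁ - 1) M₂ with hS
  have hP' : ∀ n m, P n m = s * ξ (b m (a (n + 1) v)) - ξ (b (m + 1) (a n v)) := by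
    intro n m
    simpa only [map_sub, map_smul, smul_eq_mul] using congrArg ξ (h.mixed n m v)
  have hPS : ∀ p ∉ S, P p.1 p.2 = 0 := by
    intro p hp
    have hmem : p.1 < N₁ ∨ N₂ ≤ p.1 ∨ p.2 < M₁ ∨ M₂ ≤ p.2 := by
      simp only [hS, Finset.mem_product, Finset.mem_Icc] at hp
      omega
    rcases hmem with h1 | h1 | h1 | h1
    · simp only [hP, hT]
      rw [hN₁ _ (by omega), hN₁ _ (by omega)]
      ring
    · rw [hP', hN₂ _ (by omega), hN₂ _ h1]
      simp
    · rw [hP', hM₁ _ (by omega), hM₁ _ (by omega)]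
      ring
    · simp only [hP, hT]
      rw [hM₂ _ (by omega), hM₂ _ (by omega)]
      simp
  have hTrec : ∀ n m, 1 * T (n + 1) m - s * T n (m + 1) = P n m := fun n m => by rw [one_mul]
  refine ⟨S, P, fun x y hx hy hlt => ?_, fun x y hx hy hlt => ?_, fun y hy => ?_⟩
  · have := hasSum_of_rec (T := T) one_ne_zero hs hTrec hPS (fun n hn m => hN₁ n hn _) hx hy
      (by rwa [one_mul])
    rwa [one_mul] at this
  · have := hasSum_of_rec' (T := fun n m => ξ (cont s a b n m v)) one_ne_zero hs (fun n m => by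
      have := congrArg ξ (h.cont_rec n m v)
      simp only [map_sub, map_smul, smul_eq_mul] at this
      rw [one_mul, hP', this]) hPS (fun m hm n => apply_cont_eq_zero ξ hM₁ h n hm v) hx hy
      (by rwa [one_mul])
    rwa [one_mul] at this
  · have hf : ∀ m, ξ (fused s a b m v) =
        ∑ p ∈ S, if m = p.1 + p.2 + 1 then P p.1 p.2 * s ^ (-p.1 - 1) else 0 := by
      intro m
      -- At index N₂ + 1 the continuation vanishes, and the index lies beyond every exponent in S,
      -- so every p on the right antidiagonal contributes its elementary term.
      have h1 := congrArg ξ (h.fused_eq (N₂ + 1) m v)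
      rw [cont_eq_zero hN₂ (by omega), sub_zero, map_smul, smul_eq_mul] at h1
      have h2 := eq_sum_elementary (T := T) one_ne_zero hs hTrec hPS (fun n hn m => hN₁ n hn _)
        (N₂ + 1) (m - (N₂ + 1))
      simp only [hT] at h2
      rw [h2] at h1
      rw [← mul_right_inj' (zpow_ne_zero (N₂ + 1) hs), h1, Finset.mul_sum]
      refine Finset.sum_congr rfl fun p hp => ?_
      simp only [hS, Finset.mem_product, Finset.mem_Icc] at hp
      by_cases hm : m = p.1 + p.2 + 1
      · rw [elementary, if_pos ⟨by omega, by omega⟩, if_pos hm, inv_one, one_mul, div_one,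
          mul_left_comm, ← zpow_add₀ hs]
        congr 2
        ring
      · rw [elementary, if_neg (by omega), if_neg hm, mul_zero, mul_zero]
    have h1 := hasSum_sum fun (p : ℤ × ℤ) (_ : p ∈ S) =>
      hasSum_ite_eq (p.1 + p.2 + 1) (P p.1 p.2 * s ^ (-p.1 - 1) * y ^ (-(p.1 + p.2 + 1)))
    refine hasSum_of_eq h1 (fun m => ?_) ?_
    · rw [hf, Finset.sum_mul]
      refine Finset.sum_congr rfl fun p _ => ?_
      split_ifs with hm
      · rw [hm]
      · rw [zero_mul]
    · rw [laurentPoly, Finset.sum_div]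
      refine Finset.sum_congr rfl fun p _ => ?_
      rw [laurentTerm, mul_zpow, zpow_sub_one₀ hs,
        show -(p.1 + p.2 + 1) = -p.1 + -p.2 - 1 by ring, zpow_sub_one₀ hy, zpow_add₀ hy,
        div_eq_mul_inv, mul_inv]
      ring

/-! ### Cauchy's formula at the pole w = qz. -/

theorem circleIntegral_div_of_differentiableOn {f : ℂ → ℂ} {c : ℂ} {r : ℝ} (hr : 0 < r)
    (hrc : r < ‖c‖) (hf : ∀ w, w ≠ 0 → DifferentiableAt ℂ f w) :
    (2 * π * Complex.I)⁻¹ * ∮ w in C(c, r), f w / (w - c) / w = f c / c := by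
  have hd : DifferentiableOn ℂ (fun w => f w / w) (Metric.closedBall c r) := by
    intro w hw
    have hw0 : w ≠ 0 := by
      rintro rfl
      rw [Metric.mem_closedBall, dist_zero_left] at hw
      exact absurd hw (not_le.2 hrc)
    exact ((hf w hw0).div differentiableAt_id hw0).differentiableWithinAt
  have h1 := hd.circleIntegral_sub_inv_smul (Metric.mem_ball_self hr)
  have h2 : ∀ w, (w - c)⁻¹ • (f w / w) = f w / (w - c) / w := fun w => by
    rw [smul_eq_mul]
    ring
  simp only [h2, smul_eq_mul] at h1
  rw [h1, ← mul_assoc, inv_mul_cancel₀ Complex.two_pi_I_ne_zero, one_mul]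

theorem differentiableAt_laurentPoly_fst (S : Finset (ℤ × ℤ)) (P : ℤ → ℤ → ℂ) {x y : ℂ}
    (hx : x ≠ 0) (hy : y ≠ 0) : DifferentiableAt ℂ (fun x => laurentPoly S P x y) x :=
  DifferentiableAt.comp (g := fun p : ℂ × ℂ => laurentPoly S P p.1 p.2) (f := fun x => (x, y)) x
    (analyticAt_laurentPoly S P hx hy).differentiableAt
    (differentiableAt_id.prodMk (differentiableAt_const y))

theorem differentiableAt_laurentPoly_snd (S : Finset (ℤ × ℤ)) (P : ℤ → ℤ → ℂ) {x y : ℂ}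
    (hx : x ≠ 0) (hy : y ≠ 0) : DifferentiableAt ℂ (fun y => laurentPoly S P x y) y :=
  DifferentiableAt.comp (g := fun p : ℂ × ℂ => laurentPoly S P p.1 p.2) (f := fun y => (x, y)) y
    (analyticAt_laurentPoly S P hx hy).differentiableAt
    ((differentiableAt_const x).prodMk differentiableAt_id)

end Analytic

/-! ### The composed root currents -/

section Composed

variable {V : Type*} [AddCommGroup V] [Module ℂ V] {q : ℂ} {a b : ℤ → Module.End ℂ V}
  {ξ : V →ₗ[ℂ] ℂ}

theorem composedE_eq (a b : ℤ → Module.End ℂ V) :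
    composedE q (fun n u => a n u) (fun n u => b n u) =
      fun n v => (1 * (q⁻¹ ^ 2) ^ n) • fused q⁻¹ a b n v := by
  ext n v
  rw [one_mul, inv_pow, inv_zpow', ← zpow_natCast, ← zpow_mul, mul_neg, ← neg_mul]
  rfl

/-- The contour runs over the argument of the second current of the pair, for which the outer region
is that of the continuation. This gives the sign, and setting x = q²z in δ(qw/x) gives w = qz. -/
theorem composedF_eq (h : CurrentPair q b a) :
    composedF q (fun n u => a n u) (fun n u => b n u) =
      fun n v => (-1 * q⁻¹ ^ n) • fused q b a n v := by
  ext n v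
  have h1 := h.fused_eq n n v
  rw [sub_self] at h1
  have h2 : composedF q (fun n u => a n u) (fun n u => b n u) n v =
    q ^ (-2 * n) • (cont q b a n 0 v - b n (a 0 v)) := rfl
  rw [h2, ← neg_sub, ← h1, smul_neg, smul_smul, ← zpow_add₀ h.ne_zero, neg_one_mul, neg_smul,
    inv_zpow', show -2 * n + n = -n by ring]

theorem isContourIntegral_composedE (h : CurrentPair q⁻¹ a b)
    (ha : ∃ N : ℤ, ∀ n ≤ N, ∀ v, ξ (a n v) = 0) (hb : ∃ N : ℤ, ∀ n ≤ N, ∀ v, ξ (b n v) = 0) (v : V) :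
    IsContourIntegral q (outerE (fun n u => a n u) (fun n u => b n u))
      (innerE q (fun n u => a n u) (fun n u => b n u))
      (composedE q (fun n u => a n u) (fun n u => b n u)) ξ v := by
  intro z hz
  have hq : q ≠ 0 := fun h0 => h.ne_zero (by rw [h0, inv_zero])
  have hx : q ^ 2 * z ≠ 0 := mul_ne_zero (pow_ne_zero 2 hq) hz
  have hx' : q⁻¹ * (q ^ 2 * z) = q * z := by field_simp
  have hqz : q * z ≠ 0 := mul_ne_zero hq hz
  obtain ⟨S, P, h1, h2, h3⟩ := h.matrixCoeff ha hb v
  refine ⟨fun w => laurentPoly S P w (q ^ 2 * z) / (w - q * z), ?_, ?_, ?_, ?_⟩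
  · rintro w ⟨hw, hw'⟩
    exact ((differentiableAt_laurentPoly_fst S P hw hx).div
      (differentiableAt_id.sub_const _) (sub_ne_zero.2 hw')).differentiableWithinAt
  · intro w hw
    have := h1 w (q ^ 2 * z) (norm_pos_iff.1 ((norm_nonneg _).trans_lt hw)) hx (by rwa [hx'])
    rwa [hx'] at this
  · intro w hw hlt
    have := h2 w (q ^ 2 * z) hw hx (by rwa [hx'])
    rwa [hx'] at this
  · intro r hr hrz
    rw [circleIntegral_div_of_differentiableOn hr hrz
      fun w hw => differentiableAt_laurentPoly_fst S P hw hx]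
    have := h3 (q ^ 2 * z) hx
    rw [hx'] at this
    refine hasSum_of_eq this (fun n => ?_) rfl
    rw [composedE_eq, map_smul, smul_eq_mul, one_mul, mul_zpow, inv_pow, inv_zpow']
    ring

theorem isContourIntegral_composedF (h : CurrentPair q b a)
    (ha : ∃ N : ℤ, ∀ n ≤ N, ∀ v, ξ (a n v) = 0) (hb : ∃ N : ℤ, ∀ n ≤ N, ∀ v, ξ (b n v) = 0) (v : V) :
    IsContourIntegral q (outerF q (fun n u => a n u) (fun n u => b n u))
      (innerF (fun n u => a n u) (fun n u => b n u))
      (composedF q (fun n u => a n u) (fun n u => b n u)) ξ v := by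
  intro z hz
  have hq : q ≠ 0 := h.ne_zero
  have hx : q ^ 2 * z ≠ 0 := mul_ne_zero (pow_ne_zero 2 hq) hz
  have hqz : q * z ≠ 0 := mul_ne_zero hq hz
  have hx' : q ^ 2 * z = q * (q * z) := by ring
  have hn : ‖q ^ 2 * z‖ = ‖q‖ * ‖q * z‖ := by rw [hx', norm_mul]
  have hq' := norm_pos_iff.2 hq
  obtain ⟨S, P, h1, h2, h3⟩ := h.matrixCoeff hb ha v
  -- The integration variable is the second one of the pair, so the denominator is rewritten with
  -- its pole at w = qz.
  have hΦ : ∀ w, laurentPoly S P (q ^ 2 * z) w / (q ^ 2 * z - q * w) =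
      -q⁻¹ * laurentPoly S P (q ^ 2 * z) w / (w - q * z) := by
    intro w
    rw [show q ^ 2 * z - q * w = -q * (w - q * z) by ring, div_eq_mul_inv, mul_inv, inv_neg]
    ring
  refine ⟨fun w => -q⁻¹ * laurentPoly S P (q ^ 2 * z) w / (w - q * z), ?_, ?_, ?_, ?_⟩
  · rintro w ⟨hw, hw'⟩
    exact (((differentiableAt_laurentPoly_snd S P hx hw).const_mul _).div
      (differentiableAt_id.sub_const _) (sub_ne_zero.2 hw')).differentiableWithinAt
  · intro w hw
    have := h2 (q ^ 2 * z) w hx (norm_pos_iff.1 ((norm_nonneg _).trans_lt hw))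
      (by rw [hn, norm_mul q w]; exact mul_lt_mul_of_pos_left hw hq')
    rw [hΦ, ← (Equiv.prodComm ℤ ℤ).hasSum_iff] at this
    refine hasSum_of_eq this (fun p => ?_) rfl
    exact mul_right_comm _ _ _
  · intro w hw hlt
    have := h1 (q ^ 2 * z) w hx hw
      (by rw [hn, norm_mul q w]; exact mul_lt_mul_of_pos_left hlt hq')
    rw [hΦ, ← (Equiv.prodComm ℤ ℤ).hasSum_iff] at this
    refine hasSum_of_eq this (fun p => ?_) rfl
    exact mul_right_comm _ _ _
  · intro r hr hrz
    rw [circleIntegral_div_of_differentiableOn hr hrz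
      fun w hw => (differentiableAt_laurentPoly_snd S P hx hw).const_mul _]
    refine hasSum_of_eq (h3 (q * z) hqz).neg (fun n => ?_) ?_
    · rw [composedF_eq h, map_smul, smul_eq_mul, mul_zpow, inv_zpow']
      ring
    · rw [hx']
      field_simp

end Composed

/-! ### Currents of a representation -/

section Rep

/-- Only q + q⁻¹ enters, so the e-currents may be treated with s = q⁻¹. -/
theorem serre_inv {R : Type*} [Ring R] [Algebra ℂ R] (q : ℂ) (x y : ℤ → R) :
    serre q⁻¹ x y = serre q x y := by
  ext i j k
  rw [serre, serre, serreHalf, serreHalf, serreHalf, serreHalf, inv_inv, add_comm q⁻¹ q]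

theorem map_serre {R R' : Type*} [Ring R] [Algebra ℂ R] [Ring R'] [Algebra ℂ R'] (φ : R →ₐ[ℂ] R')
    (q : ℂ) (x y : ℤ → R) (i j k : ℤ) :
    φ (serre q x y i j k) = serre q (fun n => φ (x n)) (fun n => φ (y n)) i j k := by
  simp only [serre, serreHalf, map_add, map_sub, map_mul, map_smul]

variable {ι : Type*} [DecidableEq ι] {A : Matrix ι ι ℤ} {q : ℂ}
  {V : Type*} [AddCommGroup V] [Module ℂ V] (ρ : Alg A q →ₐ[ℂ] Module.End ℂ V)

theorem eMode_exchange (i j : ι) (n m : ℤ) (u : V) :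
    ρ (eMode A q i (n + 1)) (ρ (eMode A q j m) u)
        - q ^ A i j • ρ (eMode A q i n) (ρ (eMode A q j (m + 1)) u) =
      q ^ A i j • ρ (eMode A q j m) (ρ (eMode A q i (n + 1)) u)
        - ρ (eMode A q j (m + 1)) (ρ (eMode A q i n) u) := by
  have h := congrArg (fun x => ρ x u) (RingQuot.mkAlgHom_rel ℂ (Rel.ee (A := A) (q := q) i j n m))
  simp only [map_sub, map_mul, map_smul] at h
  exact h

theorem fMode_exchange (i j : ι) (n m : ℤ) (u : V) :
    ρ (fMode A q i (n + 1)) (ρ (fMode A q j m) u)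
        - q ^ (-A i j) • ρ (fMode A q i n) (ρ (fMode A q j (m + 1)) u) =
      q ^ (-A i j) • ρ (fMode A q j m) (ρ (fMode A q i (n + 1)) u)
        - ρ (fMode A q j (m + 1)) (ρ (fMode A q i n) u) := by
  have h := congrArg (fun x => ρ x u) (RingQuot.mkAlgHom_rel ℂ (Rel.ff (A := A) (q := q) i j n m))
  simp only [map_sub, map_mul, map_smul] at h
  exact h

variable {ρ}

theorem eMode_exchange_self (hA : IsSimplyLacedCartan A) (hq : q ≠ 0) (i : ι) (n m : ℤ) (u : V) :
    q⁻¹ ^ 2 • ρ (eMode A q i (n + 1)) (ρ (eMode A q i m) u)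
        - ρ (eMode A q i n) (ρ (eMode A q i (m + 1)) u) =
      ρ (eMode A q i m) (ρ (eMode A q i (n + 1)) u)
        - q⁻¹ ^ 2 • ρ (eMode A q i (m + 1)) (ρ (eMode A q i n) u) := by
  have h := congrArg (q⁻¹ ^ 2 • ·) (eMode_exchange ρ i i n m u)
  have h1 : q⁻¹ ^ 2 * q ^ A i i = 1 := by
    rw [hA.diag, inv_pow, zpow_ofNat, inv_mul_cancel₀ (pow_ne_zero 2 hq)]
  simpa only [smul_sub, smul_smul, h1, one_smul] using h

theorem fMode_exchange_self (hA : IsSimplyLacedCartan A) (hq : q ≠ 0) (i : ι) (n m : ℤ) (u : V) :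
    q ^ 2 • ρ (fMode A q i (n + 1)) (ρ (fMode A q i m) u)
        - ρ (fMode A q i n) (ρ (fMode A q i (m + 1)) u) =
      ρ (fMode A q i m) (ρ (fMode A q i (n + 1)) u)
        - q ^ 2 • ρ (fMode A q i (m + 1)) (ρ (fMode A q i n) u) := by
  have h := congrArg (q ^ 2 • ·) (fMode_exchange ρ i i n m u)
  have h1 : q ^ 2 * q ^ (-A i i) = 1 := by
    rw [hA.diag, zpow_neg, zpow_ofNat, mul_inv_cancel₀ (pow_ne_zero 2 hq)]
  simpa only [smul_sub, smul_smul, h1, one_smul] using h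

theorem currentPair_e (hA : IsSimplyLacedCartan A) (hq : q ≠ 0) (hρ : IsHighestWeight ρ) {i j : ι}
    (hij : A i j = -1) :
    CurrentPair q⁻¹ (fun n => ρ (eMode A q i n)) (fun n => ρ (eMode A q j n)) where
  ne_zero := inv_ne_zero hq
  mixed n m u := by simpa only [hij, zpow_neg_one] using eMode_exchange ρ i j n m u
  left := eMode_exchange_self hA hq i
  right := eMode_exchange_self hA hq j
  bound_left v := (hρ v i).imp fun _ hN n hn => (hN n hn).1
  bound_right v := (hρ v j).imp fun _ hN n hn => (hN n hn).1

theorem currentPair_f (hA : IsSimplyLacedCartan A) (hq : q ≠ 0) (hρ : IsHighestWeight ρ) {i j : ι}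
    (hij : A i j = -1) :
    CurrentPair q (fun n => ρ (fMode A q i n)) (fun n => ρ (fMode A q j n)) where
  ne_zero := hq
  mixed n m u := by simpa only [hij, neg_neg, zpow_one] using fMode_exchange ρ i j n m u
  left := fMode_exchange_self hA hq i
  right := fMode_exchange_self hA hq j
  bound_left v := (hρ v i).imp fun _ hN n hn => (hN n hn).2
  bound_right v := (hρ v j).imp fun _ hN n hn => (hN n hn).2

theorem CurrentPair.isFieldFor_fused {s : ℂ} {a b : ℤ → Module.End ℂ V} (h : CurrentPair s a b)
    {ξ : V →ₗ[ℂ] ℂ} (ha : ∃ N : ℤ, ∀ n ≤ N, ∀ v, ξ (a n v) = 0)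
    (hb : ∃ N : ℤ, ∀ n ≤ N, ∀ v, ξ (b n v) = 0) : IsFieldFor ξ (fused s a b) :=
  ⟨fused_zero, h.fused_bound, h.fused_restricted ha hb⟩

theorem isFieldFor_eCur (hρ : IsHighestWeight ρ) {ξ : V →ₗ[ℂ] ℂ} (hξ : IsRestricted ρ ξ) (i : ι) :
    IsFieldFor ξ (eCur ρ i) :=
  ⟨fun _ => map_zero _, fun v => (hρ v i).imp fun _ hN n hn => (hN n hn).1,
    (hξ i).imp fun _ hN n hn v => (hN n hn v).1⟩

theorem isFieldFor_fCur (hρ : IsHighestWeight ρ) {ξ : V →ₗ[ℂ] ℂ} (hξ : IsRestricted ρ ξ) (i : ι) :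
    IsFieldFor ξ (fCur ρ i) :=
  ⟨fun _ => map_zero _, fun v => (hρ v i).imp fun _ hN n hn => (hN n hn).2,
    (hξ i).imp fun _ hN n hn v => (hN n hn v).2⟩

theorem isFieldFor_composedE (hA : IsSimplyLacedCartan A) (hq : q ≠ 0) (hρ : IsHighestWeight ρ)
    {i j : ι} (hij : A i j = -1) {ξ : V →ₗ[ℂ] ℂ} (hξ : IsRestricted ρ ξ) :
    IsFieldFor ξ (composedE q (eCur ρ i) (eCur ρ j)) := by
  have h := (currentPair_e hA hq hρ hij).isFieldFor_fused (isFieldFor_eCur hρ hξ i).restricted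
    (isFieldFor_eCur hρ hξ j).restricted
  exact (composedE_eq (q := q) (fun n => ρ (eMode A q i n)) (fun n => ρ (eMode A q j n))).symm ▸
    h.rescale fun n => 1 * (q⁻¹ ^ 2) ^ n

theorem isFieldFor_composedF (hA : IsSimplyLacedCartan A) (hq : q ≠ 0) (hρ : IsHighestWeight ρ)
    {i j : ι} (hji : A j i = -1) {ξ : V →ₗ[ℂ] ℂ} (hξ : IsRestricted ρ ξ) :
    IsFieldFor ξ (composedF q (fCur ρ i) (fCur ρ j)) := by
  have h := (currentPair_f hA hq hρ hji).isFieldFor_fused (isFieldFor_fCur hρ hξ j).restricted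
    (isFieldFor_fCur hρ hξ i).restricted
  exact (composedF_eq (currentPair_f hA hq hρ hji)).symm ▸ h.rescale fun n => -1 * q⁻¹ ^ n

theorem serreE_iff (i j : ι) : SerreE ρ i j ↔ ∀ n₁ n₂ m,
    serre q⁻¹ (fun n => ρ (eMode A q i n)) (fun n => ρ (eMode A q j n)) n₁ n₂ m = 0 := by
  simp only [SerreE, map_serre, serre_inv]

theorem serreF_iff (i j : ι) : SerreF ρ i j ↔ ∀ n₁ n₂ m,
    serre q (fun n => ρ (fMode A q i n)) (fun n => ρ (fMode A q j n)) n₁ n₂ m = 0 := by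
  simp only [SerreF, map_serre]

/-! ### The four Serre relations in terms of the rescaled fused current. -/

theorem serreE_iff_exchange_left (hA : IsSimplyLacedCartan A) (hq : q ≠ 0)
    (hρ : IsHighestWeight ρ) {i j : ι} (hij : A i j = -1) :
    SerreE ρ i j ↔ Exchange q 1 1 q (eCur ρ i) (composedE q (eCur ρ i) (eCur ρ j)) := by
  have hτ : q⁻¹ ^ 2 ≠ 0 := pow_ne_zero 2 (inv_ne_zero hq)
  have h1 := exchange_rescale_right (a := q) (b := 1) (c := 1) (fun n => ρ (eMode A q i n))
    (fused q⁻¹ (fun n => ρ (eMode A q i n)) (fun n => ρ (eMode A q j n))) one_ne_zero hτ hq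
  -- Rescaling by τ = q⁻² turns the target factor into (q³z - w)/(q²z - qw), which is the fused
  -- factor with numerator and denominator multiplied by q².
  have h2 := exchange_homogeneous (a := q⁻¹⁻¹) (b := q⁻¹ ^ 2) (c := 1) (d := q⁻¹)
    (fun n u => ρ (eMode A q i n) u)
    (fused q⁻¹ (fun n => ρ (eMode A q i n)) (fun n => ρ (eMode A q j n))) (inv_ne_zero hq)
    (pow_ne_zero 2 hq)
  rw [serreE_iff, (currentPair_e hA hq hρ hij).serre_left_iff, ← h2]
  rw [← composedE_eq] at h1
  refine Iff.trans (Eq.to_iff ?_) h1.symm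
  congr 1 <;> field_simp

theorem serreE_iff_exchange_right (hA : IsSimplyLacedCartan A) (hq : q ≠ 0)
    (hρ : IsHighestWeight ρ) {i j : ι} (hij : A i j = -1) :
    SerreE ρ j i ↔ Exchange (q ^ 2) (q⁻¹ ^ 2) q q⁻¹
      (composedE q (eCur ρ i) (eCur ρ j)) (eCur ρ j) := by
  have hτ : q⁻¹ ^ 2 ≠ 0 := pow_ne_zero 2 (inv_ne_zero hq)
  have h1 := exchange_rescale_left (a := q ^ 2) (b := q⁻¹ ^ 2) (c := q)
    (fused q⁻¹ (fun n => ρ (eMode A q i n)) (fun n => ρ (eMode A q j n)))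
    (fun n => ρ (eMode A q j n)) one_ne_zero hτ (inv_ne_zero hq)
  rw [serreE_iff, (currentPair_e hA hq hρ hij).serre_right_iff]
  rw [← composedE_eq] at h1
  refine Iff.trans (Eq.to_iff ?_) h1.symm
  congr 1 <;> field_simp

theorem serreF_iff_exchange_left (hA : IsSimplyLacedCartan A) (hq : q ≠ 0)
    (hρ : IsHighestWeight ρ) {i j : ι} (hji : A j i = -1) :
    SerreF ρ j i ↔ Exchange (q⁻¹ ^ 2) (q ^ 2) q⁻¹ q
      (fCur ρ j) (composedF q (fCur ρ i) (fCur ρ j)) := by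
  have h := currentPair_f hA hq hρ hji
  have h1 := exchange_rescale_right (a := q⁻¹ ^ 2) (b := q ^ 2) (c := q⁻¹)
    (fun n => ρ (fMode A q j n))
    (fused q (fun n => ρ (fMode A q j n)) (fun n => ρ (fMode A q i n)))
    (neg_ne_zero.2 one_ne_zero) (inv_ne_zero hq) hq
  rw [serreF_iff, h.serre_left_iff]
  rw [← composedF_eq h] at h1
  refine Iff.trans (Eq.to_iff ?_) h1.symm
  congr 1 <;> field_simp

theorem serreF_iff_exchange_right (hA : IsSimplyLacedCartan A) (hq : q ≠ 0)
    (hρ : IsHighestWeight ρ) {i j : ι} (hji : A j i = -1) :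
    SerreF ρ i j ↔ Exchange q⁻¹ 1 1 q⁻¹ (composedF q (fCur ρ i) (fCur ρ j)) (fCur ρ i) := by
  have h := currentPair_f hA hq hρ hji
  have h1 := exchange_rescale_left (a := q⁻¹) (b := 1) (c := 1)
    (fused q (fun n => ρ (fMode A q j n)) (fun n => ρ (fMode A q i n)))
    (fun n => ρ (fMode A q i n)) (neg_ne_zero.2 one_ne_zero) (inv_ne_zero hq) (inv_ne_zero hq)
  have h2 := exchange_homogeneous (a := 1) (b := q ^ 2) (c := q) (d := q)
    (fused q (fun n => ρ (fMode A q j n)) (fun n => ρ (fMode A q i n)))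
    (fun n u => ρ (fMode A q i n) u) hq (pow_ne_zero 2 (inv_ne_zero hq))
  rw [serreF_iff, h.serre_right_iff, ← h2]
  rw [← composedF_eq h] at h1
  refine Iff.trans (Eq.to_iff ?_) h1.symm
  congr 1 <;> field_simp

end Rep

end

end DrinfeldCurrent

theorem proposition1 {ι : Type*} [DecidableEq ι] (A : Matrix ι ι ℤ) (hA : IsSimplyLacedCartan A)
    (q : ℂ) (hq : q ≠ 0) (hq2 : q ^ 2 ≠ 1)
    {V : Type*} [AddCommGroup V] [Module ℂ V] (ρ : Alg A q →ₐ[ℂ] Module.End ℂ V)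
    (hρ : IsHighestWeight ρ) (α β : ι) (hαβ : A α β = -1) :
    -- the composed root currents are contour integrals of the continued products
    (∀ (ξ : V →ₗ[ℂ] ℂ) (v : V), IsRestricted ρ ξ →
      IsContourIntegral q (outerE (eCur ρ α) (eCur ρ β)) (innerE q (eCur ρ α) (eCur ρ β))
        (composedE q (eCur ρ α) (eCur ρ β)) ξ v ∧
      IsContourIntegral q (outerF q (fCur ρ α) (fCur ρ β)) (innerF (fCur ρ α) (fCur ρ β))
        (composedF q (fCur ρ α) (fCur ρ β)) ξ v) ∧
    -- e_α(z) e_{α+β}(w) = (q z - w)/(z - q w) e_{α+β}(w) e_α(z)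
    EquivalentToExchange ρ (SerreE ρ α β) q 1 1 q
      (eCur ρ α) (composedE q (eCur ρ α) (eCur ρ β)) ∧
    -- e_{α+β}(z) e_β(w) = (q² z - q⁻² w)/(q z - q⁻¹ w) e_β(w) e_{α+β}(z)
    EquivalentToExchange ρ (SerreE ρ β α) (q ^ 2) (q⁻¹ ^ 2) q q⁻¹
      (composedE q (eCur ρ α) (eCur ρ β)) (eCur ρ β) ∧
    -- f_β(z) f_{α+β}(w) = (q⁻² z - q² w)/(q⁻¹ z - q w) f_{α+β}(w) f_β(z)
    EquivalentToExchange ρ (SerreF ρ β α) (q⁻¹ ^ 2) (q ^ 2) q⁻¹ q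
      (fCur ρ β) (composedF q (fCur ρ α) (fCur ρ β)) ∧
    -- f_{α+β}(z) f_α(w) = (q⁻¹ z - w)/(z - q⁻¹ w) f_α(w) f_{α+β}(z)
    EquivalentToExchange ρ (SerreF ρ α β) q⁻¹ 1 1 q⁻¹
      (composedF q (fCur ρ α) (fCur ρ β)) (fCur ρ α) := by
  have hβα : A β α = -1 := by rw [hA.symm, hαβ]
  have hq' := inv_ne_zero hq
  have hs := pow_ne_zero 2 hq
  have hs' := pow_ne_zero 2 hq'
  have hE := fun ξ (hξ : IsRestricted ρ ξ) => isFieldFor_composedE hA hq hρ hαβ hξ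
  have hF := fun ξ (hξ : IsRestricted ρ ξ) => isFieldFor_composedF hA hq hρ hβα hξ
  have he := fun i ξ (hξ : IsRestricted ρ ξ) => isFieldFor_eCur hρ hξ i
  have hf := fun i ξ (hξ : IsRestricted ρ ξ) => isFieldFor_fCur hρ hξ i
  refine ⟨fun ξ v hξ => ⟨?_, ?_⟩, ?_, ?_, ?_, ?_⟩
  · exact isContourIntegral_composedE (currentPair_e hA hq hρ hαβ) (he α ξ hξ).restricted
      (he β ξ hξ).restricted v
  · exact isContourIntegral_composedF (currentPair_f hA hq hρ hβα) (hf α ξ hξ).restricted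
      (hf β ξ hξ).restricted v
  · exact equivalentToExchange hq one_ne_zero one_ne_zero hq (he α) hE
      (serreE_iff_exchange_left hA hq hρ hαβ)
  · exact equivalentToExchange hs hs' hq hq' hE (he β) (serreE_iff_exchange_right hA hq hρ hαβ)
  · exact equivalentToExchange hs' hs hq' hq (hf β) hF (serreF_iff_exchange_left hA hq hρ hβα)
  · exact equivalentToExchange hq' one_ne_zero one_ne_zero hq' hF (hf α)
      (serreF_iff_exchange_right hA hq hρ hβα)
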